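/- Let $g=\frac{1}{1+|z|^2}\,dz\otimes d\bar z$ be the cigar metric on $\mathbb C$. (1) The diastasis of $g$ is globally defined and positive, in the following sense. Let $W=\{(z,w)\in\mathbb C\times\mathbb C : z\bar w\notin(-\infty,-1]\}$, a connected open neighbourhood of the diagonal of $\mathbb C\times\mathbb C$. There is a continuous function $D:\mathbb C\times\mathbb C\to\mathbb R$ which on $W$ is the diastasis function of $g$, that is, $$D(z,w)=\Phi(z,\bar z)+\Phi(w,\bar w)-\Phi(z,\bar w)-\Phi(w,\bar z)\qquad\text{for }(z,w)\in W,$$ where $\Phi(z)=\Phi(z,\bar z)$ is a real analytic Kähler potential of $g$ on $\mathbb C$ (i.e. $\partial^2\Phi/\partial z\,\partial\bar z=1/(1+|z|^2)$) and $\Phi(z,\bar w)$, $(z,w)\in W$, is its analytic continuation, holomorphic in $z$ and in $\bar w$. Moreover $D(z,w)\ge 0$ for all $z,w\in\mathbb C$, and $D(z,w)>0$ whenever $z\neq w$. (2) For every $c>0$, $(\mathbb C,c\,g)$ admits no local Kähler immersion into any complex space form: for all $N\in\{0,1,2,\dots\}\cup\{\infty\}$ and $b\in\mathbb R$, and every non-empty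 open set $U\subseteq\mathbb C$, there is no holomorphic map $f:U\to F(N,b)$ with $f^*g_b=c\,g$ on $U$. Here $F(N,b)$ is the complete simply connected complex space form of complex dimension $N$ and holomorphic sectional curvature $4b$, with metric $g_b$: for $b=0$ the space $\mathbb C^N$ with the flat metric; for $b<0$ the ball $\{x\in\mathbb C^N:\|x\|^2<-1/b\}$ with the metric of Kähler potential $\frac1b\log(1+b\|x\|^2)$; for $b>0$ the projective space $\mathbb C\mathrm P^N$ of lines in $\mathbb C^{N+1}$ with the Fubini–Study metric of local Kähler potential $\frac1b\log\|Z\|^2$ in homogeneous coordinates $Z$; and $\mathbb C^\infty=\ell^2(\mathbb C)$. -/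

import Mathlib

open scoped ComplexConjugate InnerProductSpace LinearAlgebra.Projectivization

noncomputable section

namespace Kahler

/-! A Hermitian metric `h(z) dz ⊗ dz̄` on `ℂ` (or on an open subset of it) is given by its
coefficient `h : ℂ → ℝ`.  On a complex curve every such metric is a Kähler metric. -/

/-- The coefficient of the cigar metric `dz ⊗ dz̄ / (1 + |z|²)`. -/
def cigar (z : ℂ) : ℝ := 1 / (1 + ‖z‖ ^ 2)

/-! ### Kähler potentials and the diastasis -/

/-- The Wirtinger derivative `∂/∂z`. -/
def dz (f : ℂ → ℂ) (z : ℂ) : ℂ :=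
  (fderiv ℝ f z 1 - Complex.I * fderiv ℝ f z Complex.I) / 2

/-- The Wirtinger derivative `∂/∂z̄`. -/
def dzbar (f : ℂ → ℂ) (z : ℂ) : ℂ :=
  (fderiv ℝ f z 1 + Complex.I * fderiv ℝ f z Complex.I) / 2

/-- `Φ` is a (global) real analytic Kähler potential on `ℂ` of the metric `h dz ⊗ dz̄`:
`∂²Φ/∂z∂z̄ = h`. -/
def IsKahlerPotential (h : ℂ → ℝ) (Φ : ℂ → ℝ) : Prop :=
  AnalyticOnNhd ℝ Φ Set.univ ∧ ∀ z, dz (dzbar fun w => (Φ w : ℂ)) z = (h z : ℂ)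

/-- `D` is, on `W`, Calabi's diastasis function of the metric `h dz ⊗ dz̄` on `ℂ`.
Here `W` is a connected open neighbourhood of the diagonal of `ℂ × ℂ`, symmetric under the swap,
`Φ` is a real analytic Kähler potential, `P` is its analytic continuation, i.e. `(z, u) ↦ P (z, u)`
is holomorphic on `{(z, w̄) | (z, w) ∈ W}` and `P (z, z̄) = Φ z`, and
`D(z, w) = Φ(z, z̄) + Φ(w, w̄) - Φ(z, w̄) - Φ(w, z̄)` for `(z, w) ∈ W`. -/
def IsDiastasisOn (h : ℂ → ℝ) (D : ℂ → ℂ → ℝ) (W : Set (ℂ × ℂ)) : Prop :=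
  IsOpen W ∧ IsConnected W ∧ (∀ z, (z, z) ∈ W) ∧ (∀ z w, (z, w) ∈ W → (w, z) ∈ W) ∧
  ∃ (Φ : ℂ → ℝ) (P : ℂ × ℂ → ℂ),
    IsKahlerPotential h Φ ∧
    DifferentiableOn ℂ P {q | (q.1, conj q.2) ∈ W} ∧
    (∀ z, P (z, conj z) = (Φ z : ℂ)) ∧
    ∀ z w, (z, w) ∈ W →
      (D z w : ℂ) = (Φ z : ℂ) + (Φ w : ℂ) - P (z, conj w) - P (w, conj z)

/-! ### Complex space forms `F(N, b)`, `N ≤ ∞`, of holomorphic sectional curvature `4b` -/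

/-- `ℂ^N` for `N ≤ ∞` with its Hermitian norm, where `ℂ^∞ = ℓ²(ℂ)`. -/
abbrev CSpace (N : ℕ∞) : Type := lp (fun _ : {j : ℕ // (j : ℕ∞) < N} => ℂ) 2

/-- `ℂP^N` for `N ≤ ∞`: the lines in `ℂ^(N+1)`. -/
abbrev CProj (N : ℕ∞) : Type := ℙ ℂ (CSpace (N + 1))

section Metrics

variable {H : Type*} [NormedAddCommGroup H] [InnerProductSpace ℂ H]

/-- The metric of `F(N, b)`, `b ≤ 0`, at the point `x` of the domain `1 + b‖x‖² > 0` (all of `ℂ^N`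
for `b = 0`, the ball `‖x‖² < -1/b` for `b < 0`), evaluated at `(v, v)`.
It is `∂∂̄` of `(1/b) log (1 + b‖x‖²)` for `b < 0`, and of `‖x‖²` for `b = 0`. -/
def ballMetric (b : ℝ) (x v : H) : ℝ :=
  ‖v‖ ^ 2 / (1 + b * ‖x‖ ^ 2) - b * ‖⟪x, v⟫_ℂ‖ ^ 2 / (1 + b * ‖x‖ ^ 2) ^ 2

/-- The Fubini-Study metric of holomorphic sectional curvature `4b`, `b > 0`, at the point `[Z]`,
evaluated at `(w, w)` for the tangent vector `w` that is the image of `v` under the differential of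
`Z ↦ [Z]`.  It is `∂∂̄` of `(1/b) log ‖Z‖²`. -/
def fubiniStudy (b : ℝ) (Z v : H) : ℝ :=
  (‖Z‖ ^ 2 * ‖v‖ ^ 2 - ‖⟪Z, v⟫_ℂ‖ ^ 2) / (b * ‖Z‖ ^ 4)

/-- `f` is a Kähler (holomorphic and isometric) immersion of `(U, h dz ⊗ dz̄)` into the flat space
(`b = 0`) or into the ball with the hyperbolic metric of holomorphic sectional curvature `4b`
(`b < 0`). -/
def IsKahlerImmersionBall (b : ℝ) (h : ℂ → ℝ) (U : Set ℂ) (f : ℂ → H) : Prop :=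
  DifferentiableOn ℂ f U ∧ (∀ z ∈ U, 0 < 1 + b * ‖f z‖ ^ 2) ∧
  ∀ z ∈ U, ballMetric b (f z) (deriv f z) = h z

/-- `f` is a Kähler (holomorphic and isometric) immersion of `(U, h dz ⊗ dz̄)` into the projective
space with the Fubini-Study metric of holomorphic sectional curvature `4b`, `b > 0`.
Holomorphy means that locally `f = [F]` with `F` holomorphic and without zeros. -/
def IsKahlerImmersionProj (b : ℝ) (h : ℂ → ℝ) (U : Set ℂ) (f : ℂ → ℙ ℂ H) : Prop :=
  ∀ p ∈ U, ∃ V : Set ℂ, IsOpen V ∧ p ∈ V ∧ V ⊆ U ∧ ∃ F : ℂ → H,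
    DifferentiableOn ℂ F V ∧
    (∀ z ∈ V, ∃ hz : F z ≠ 0, f z = Projectivization.mk ℂ (F z) hz) ∧
    ∀ z ∈ V, fubiniStudy b (F z) (deriv F z) = h z

end Metrics

/-- The open subset `U` of `ℂ` with the metric `h dz ⊗ dz̄` admits a Kähler immersion into the
complex space form `F(N, b)`. -/
def AdmitsKahlerImmersion (N : ℕ∞) (b : ℝ) (h : ℂ → ℝ) (U : Set ℂ) : Prop :=
  (0 < b ∧ ∃ f : ℂ → CProj N, IsKahlerImmersionProj b h U f) ∨
  (b ≤ 0 ∧ ∃ f : ℂ → CSpace N, IsKahlerImmersionBall b h U f)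

end Kahler

end

/-! Diastasis. With `L x = -Li₂ (-x) = ∫₀¹ log (1 + t x) / t dt`, the function `L (|z|²)` is a
potential, since `∂∂̄` of it is `L' + x L'' = (x L')' = (log (1 + x))' = 1 / (1 + x)` at `x = |z|²`;
its continuation is `L (z u)`. Hence the diastasis is the integral over `t` of `log ((1 + t|z|²) (1
+ t|w|²) / |1 + t z w̄|²) / t`, and numerator minus denominator is `t |z - w|²`, which gives
positivity (`two_mul_log_norm_lt`). Only `log |1 + t x|` enters, so `D` extends across the cut,
continuously by dominated convergence (`continuous_dilogNegRe`).

Targets with `b ≤ 0`. The curvature of a complex submanifold is at most that of the ambient space,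
while the cigar is positively curved. Concretely, the Gram determinant of `f'` and `f''` for a
positive semidefinite form would equal a negative number (`gram_identity`,
`not_ball_immersion_cigar`).

Targets with `b > 0`. In the coordinate `p eᶻ` the metric depends only on `z + z̄`. An immersion
therefore yields a Hilbert-space map `G` with `⟪G w, G z⟫ = γ (z + w̄)`, where `(log γ)'' = bc P eˢ
/ (1 + P eˢ)` and `P = |p|²` (`exists_inner_eq_exp`). Positive definiteness bounds the derivatives
of `γ` at `i y` by those at `0`, so the Taylor series at `i y` converges on discs as large as at `0`
(`exists_continuation_of_inner_eq`). The point `s₀ = -log P + iπ`, a singularity of the equation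
nearest to `0`, is strictly nearer to `i y` for small `y > 0`; thus `γ` would continue
holomorphically to `s₀`. This is impossible: there `(log γ)''` would have a simple pole with
non-zero residue, whereas a second logarithmic derivative of a holomorphic function has only pure
double poles (`not_analyticAt_of_log_ode`). -/

namespace Kahler

open Metric Filter Topology MeasureTheory

/-! ### Polarization of real analytic identities -/

section Polarization

/-- A holomorphic function on a disc that vanishes at the real points near the center vanishes. -/
theorem eqOn_zero_of_real_eq_zero {f : ℂ → ℂ} {r : ℝ} (hr : 0 < r)
    (hf : DifferentiableOn ℂ f (ball 0 r)) (h : ∀ x : ℝ, |x| < r → f x = 0) :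
    ∀ x ∈ ball (0 : ℂ) r, f x = 0 := by
  have hfa : AnalyticOnNhd ℂ f (ball 0 r) := hf.analyticOnNhd isOpen_ball
  have key := hfa.eqOn_zero_of_preconnected_of_frequently_eq_zero
    (convex_ball (0 : ℂ) r).isPreconnected (mem_ball_self hr) ?_
  · exact key
  have ht : Tendsto (fun x : ℝ => (x : ℂ)) (𝓝[≠] 0) (𝓝[≠] 0) := by
    refine tendsto_nhdsWithin_iff.2 ⟨?_, ?_⟩
    · exact (Complex.continuous_ofReal.tendsto' 0 0 (by simp)).mono_left nhdsWithin_le_nhds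
    · filter_upwards [self_mem_nhdsWithin] with x hx
      simpa using hx
  refine ht.frequently (Eventually.frequently ?_)
  have : ∀ᶠ x : ℝ in 𝓝 0, |x| < r := by
    have := (continuous_abs : Continuous (fun x : ℝ => |x|)).tendsto 0
    rw [abs_zero] at this
    exact this.eventually (gt_mem_nhds hr)
  filter_upwards [this.filter_mono nhdsWithin_le_nhds] with x hx using h x hx

/-- Polarization: holomorphic functions of `(z, u)` that agree for `u = z̄` agree. -/
theorem eq_of_eq_on_conj_diagonal {A B : ℂ × ℂ → ℂ} {p : ℂ} {r : ℝ} (hr : 0 < r)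
    (hA : DifferentiableOn ℂ A (ball p r ×ˢ ball (conj p) r))
    (hB : DifferentiableOn ℂ B (ball p r ×ˢ ball (conj p) r))
    (h : ∀ z ∈ ball p r, A (z, conj z) = B (z, conj z)) {z u : ℂ}
    (hz : z ∈ ball p (r / 4)) (hu : u ∈ ball (conj p) (r / 4)) : A (z, u) = B (z, u) := by
  -- In the coordinates `z = p + x + iy`, `u = p̄ + x - iy`, the set `u = z̄` is the set of real
  -- `x`, `y`. The one-variable identity theorem then applies in `x` and in `y` successively.
  set C : ℂ → ℂ → ℂ := fun x y =>
    A (p + (x + Complex.I * y), conj p + (x - Complex.I * y)) -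
      B (p + (x + Complex.I * y), conj p + (x - Complex.I * y)) with hC
  have hr4 : 0 < r / 4 := by positivity
  have mem : ∀ x ∈ ball (0 : ℂ) (r / 4), ∀ y ∈ ball (0 : ℂ) (r / 4),
      (p + (x + Complex.I * y), conj p + (x - Complex.I * y)) ∈ ball p r ×ˢ ball (conj p) r := by
    intro x hx y hy
    rw [mem_ball_zero_iff] at hx hy
    have hIy : ‖Complex.I * y‖ = ‖y‖ := by simp
    have h1 := norm_add_le x (Complex.I * y)
    have h2 := norm_sub_le x (Complex.I * y)
    rw [hIy] at h1 h2
    refine ⟨?_, ?_⟩ <;> simp only [mem_ball, dist_eq_norm, add_sub_cancel_left] <;> linarith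
  have hreal : ∀ x : ℝ, |x| < r / 4 → ∀ y : ℝ, |y| < r / 4 → C x y = 0 := by
    intro x hx y hy
    have hm := (mem x (by simpa using hx) y (by simpa using hy)).1
    have := h _ hm
    have e : conj (p + ((x : ℂ) + Complex.I * y)) = conj p + (x - Complex.I * y) := by
      simp [sub_eq_add_neg]
    rw [e] at this
    simp only [hC]
    rw [this, sub_self]
  have h1 : ∀ y : ℝ, |y| < r / 4 → ∀ x ∈ ball (0 : ℂ) (r / 4), C x y = 0 := by
    intro y hy
    refine eqOn_zero_of_real_eq_zero hr4 ?_ fun x hx => hreal x hx y hy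
    have hd : DifferentiableOn ℂ (fun x : ℂ =>
        (p + (x + Complex.I * y), conj p + (x - Complex.I * y))) (ball 0 (r / 4)) := by fun_prop
    exact (hA.comp hd fun x hx => mem x hx y (by simpa using hy)).sub
      (hB.comp hd fun x hx => mem x hx y (by simpa using hy))
  have h2 : ∀ x ∈ ball (0 : ℂ) (r / 4), ∀ y ∈ ball (0 : ℂ) (r / 4), C x y = 0 := by
    intro x hx
    refine eqOn_zero_of_real_eq_zero hr4 ?_ fun y hy => h1 y hy x hx
    have hd : DifferentiableOn ℂ (fun y : ℂ =>
        (p + (x + Complex.I * y), conj p + (x - Complex.I * y))) (ball 0 (r / 4)) := by fun_prop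
    exact (hA.comp hd fun y hy => mem x hx y hy).sub (hB.comp hd fun y hy => mem x hx y hy)
  rw [mem_ball, dist_eq_norm] at hz hu
  have h3 := h2 (((z - p) + (u - conj p)) / 2) ?_ (((z - p) - (u - conj p)) / (2 * Complex.I)) ?_
  · have e1 : p + (((z - p) + (u - conj p)) / 2 +
        Complex.I * (((z - p) - (u - conj p)) / (2 * Complex.I))) = z := by
      field_simp; ring
    have e2 : conj p + (((z - p) + (u - conj p)) / 2 -
        Complex.I * (((z - p) - (u - conj p)) / (2 * Complex.I))) = u := by
      field_simp; ring
    simp only [hC] at h3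
    rw [e1, e2] at h3
    exact sub_eq_zero.1 h3
  · rw [mem_ball_zero_iff, norm_div]
    have := norm_add_le (z - p) (u - conj p)
    simp only [Complex.norm_ofNat]
    linarith
  · rw [mem_ball_zero_iff, norm_div]
    have := norm_sub_le (z - p) (u - conj p)
    simp only [Complex.norm_mul, Complex.norm_ofNat, Complex.norm_I, mul_one]
    linarith

end Polarization

/-! ### Holomorphy of sesquilinear expressions -/

section Inner

variable {H : Type*} [NormedAddCommGroup H] [InnerProductSpace ℂ H]

/-- The two antilinear maps, conjugation of `u` and `innerSL`, cancel to a complex linear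
derivative. Both are isometric, so the remainder estimate carries over unchanged. -/
theorem hasDerivAt_innerSL_conj {f : ℂ → H} {f' : H} {u : ℂ} (hf : HasDerivAt f f' (conj u)) :
    HasDerivAt (fun u => innerSL ℂ (f (conj u))) (innerSL ℂ f') u := by
  rw [hasDerivAt_iff_isLittleO] at hf ⊢
  have ht : Tendsto (fun v : ℂ => conj v) (𝓝 u) (𝓝 (conj u)) :=
    Complex.continuous_conj.tendsto u
  have := hf.comp_tendsto ht
  refine (Asymptotics.isLittleO_iff.2 fun c hc => ?_)
  filter_upwards [Asymptotics.isLittleO_iff.1 this hc] with v hv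
  have e : innerSL ℂ (f (conj v)) - innerSL ℂ (f (conj u)) - (v - u) • innerSL ℂ f' =
      innerSL ℂ (f (conj v) - f (conj u) - (conj v - conj u) • f') := by
    simp [map_sub]
  rw [e, innerSL_apply_norm]
  simpa [← map_sub] using hv

theorem hasDerivAt_inner_conj_left {f : ℂ → H} {f' : H} {u : ℂ} (v : H)
    (hf : HasDerivAt f f' (conj u)) :
    HasDerivAt (fun u => ⟪f (conj u), v⟫_ℂ) ⟪f', v⟫_ℂ u := by
  have := (hasDerivAt_innerSL_conj hf).clm_apply (hasDerivAt_const u v)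
  simpa using this

theorem hasDerivAt_inner_right {g : ℂ → H} {g' : H} {z : ℂ} (v : H) (hg : HasDerivAt g g' z) :
    HasDerivAt (fun z => ⟪v, g z⟫_ℂ) ⟪v, g'⟫_ℂ z := by
  exact (innerSL ℂ v).hasFDerivAt.comp_hasDerivAt z hg

theorem conj_mem_ball {z p : ℂ} {r : ℝ} : conj z ∈ ball p r ↔ z ∈ ball (conj p) r := by
  rw [mem_ball, mem_ball, ← Complex.dist_conj_conj, Complex.conj_conj]

/-- `(z, u) ↦ ⟪f (ū), g z⟫` is holomorphic if `f` and `g` are. -/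
theorem differentiableOn_inner_conj {f g : ℂ → H} {p : ℂ} {r : ℝ}
    (hf : DifferentiableOn ℂ f (ball p r)) (hg : DifferentiableOn ℂ g (ball p r)) :
    DifferentiableOn ℂ (fun q : ℂ × ℂ => ⟪f (conj q.2), g q.1⟫_ℂ)
      (ball p r ×ˢ ball (conj p) r) := by
  have h1 : DifferentiableOn ℂ (fun u => innerSL ℂ (f (conj u))) (ball (conj p) r) := by
    intro u hu
    exact (hasDerivAt_innerSL_conj
      (hf.hasDerivAt (isOpen_ball.mem_nhds (conj_mem_ball.2 hu)))).differentiableAt.differentiableWithinAt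
  have h2 : DifferentiableOn ℂ (fun q : ℂ × ℂ => innerSL ℂ (f (conj q.2)))
      (ball p r ×ˢ ball (conj p) r) :=
    h1.comp (differentiable_snd.differentiableOn) fun q hq => hq.2
  have h3 : DifferentiableOn ℂ (fun q : ℂ × ℂ => g q.1) (ball p r ×ˢ ball (conj p) r) :=
    hg.comp (differentiable_fst.differentiableOn) fun q hq => hq.1
  simpa using h2.clm_apply h3

end Inner

theorem hasDerivAt_value_eq {f g : ℂ → ℂ} {f' g' x : ℂ} {S : Set ℂ} (hf : HasDerivAt f f' x)
    (hg : HasDerivAt g g' x) (hS : S ∈ 𝓝 x) (h : ∀ w ∈ S, f w = g w) : f' = g' :=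
  hf.unique (hg.congr_of_eventuallyEq (eventually_of_mem hS h))

/-! ### Flat and hyperbolic targets -/

section Ball

variable {H : Type*} [NormedAddCommGroup H] [InnerProductSpace ℂ H]

/-- Cauchy-Schwarz for the positive semidefinite form `A ⟪x, y⟫ + β ⟪x, e⟫ ⟪e, y⟫`. -/
theorem norm_sq_inner_add_mul_le {A β : ℝ} (hA : 0 ≤ A) (hβ : 0 ≤ β) (e x y : H) :
    ‖(A : ℂ) * ⟪x, y⟫_ℂ + β * (⟪x, e⟫_ℂ * ⟪e, y⟫_ℂ)‖ ^ 2 ≤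
      (A * ‖x‖ ^ 2 + β * ‖⟪e, x⟫_ℂ‖ ^ 2) * (A * ‖y‖ ^ 2 + β * ‖⟪e, y⟫_ℂ‖ ^ 2) := by
  have h1 : ‖(A : ℂ) * ⟪x, y⟫_ℂ + β * (⟪x, e⟫_ℂ * ⟪e, y⟫_ℂ)‖ ≤
      A * (‖x‖ * ‖y‖) + β * (‖⟪e, x⟫_ℂ‖ * ‖⟪e, y⟫_ℂ‖) := by
    refine (norm_add_le _ _).trans ?_
    rw [norm_mul, norm_mul, norm_mul, Complex.norm_of_nonneg hA, Complex.norm_of_nonneg hβ,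
      norm_inner_symm x e]
    gcongr
    exact norm_inner_le_norm x y
  refine (pow_le_pow_left₀ (norm_nonneg _) h1 2).trans ?_
  -- This product is exactly the defect in the two-term Cauchy-Schwarz inequality with weights `A`
  -- and `β`.
  have := mul_nonneg (mul_nonneg hA hβ) (sq_nonneg (‖x‖ * ‖⟪e, y⟫_ℂ‖ - ‖⟪e, x⟫_ℂ‖ * ‖y‖))
  linarith

/-- The Gauss equation in disguise. Subscripts 1 and 2 stand for `∂/∂z` and `∂/∂u`. From `J = c A² /
X` the mixed derivative of `log J` is `2 (log A)₁₂ - (log X)₁₂ = 2 b J / A² - 1 / X²`, and `J J₁₂ -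
J₁ J₂` is `J²` times it. -/
theorem gram_identity {X z u A A₁ A₂ A₁₂ J J₁ J₂ J₁₂ b c : ℂ} (hX : X = 1 + z * u) (hX0 : X ≠ 0)
    (hA : A ≠ 0) (h : X * J = c * A ^ 2) (h₁ : u * J + X * J₁ = c * (2 * A * A₁))
    (h₂ : z * J + X * J₂ = c * (2 * A * A₂))
    (h₁₂ : J + z * J₁ + u * J₂ + X * J₁₂ = c * (2 * (A₁ * A₂ + A * A₁₂)))
    (hb : A * A₁₂ - A₁ * A₂ = b * J) :
    X ^ 4 * (J * J₁₂ - J₁ * J₂) = (2 * b * c ^ 3 * X - c ^ 2) * A ^ 4 := by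
  have e : J = c * A ^ 2 / X := by field_simp; linear_combination h
  have e₁ : J₁ = (c * (2 * A * A₁) - u * J) / X := by field_simp; linear_combination h₁
  have e₂ : J₂ = (c * (2 * A * A₂) - z * J) / X := by field_simp; linear_combination h₂
  have e₁₂ : J₁₂ = (c * (2 * (A₁ * A₂ + A * A₁₂)) - J - z * J₁ - u * J₂) / X := by
    field_simp; linear_combination h₁₂
  have ea : A₁₂ = (b * J + A₁ * A₂) / A := by field_simp; linear_combination hb
  rw [e₁₂, e₁, e₂, ea, e]
  field_simp
  rw [hX]
  ring

/-- The polarized form of `f^* g_b = c • cigar` for `b ≤ 0`. -/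
theorem ball_polarized {b c r : ℝ} {p : ℂ} (hr : 0 < r) [CompleteSpace H] {f : ℂ → H}
    (hf : DifferentiableOn ℂ f (ball p r)) (hpos : ∀ z ∈ ball p r, 0 < 1 + b * ‖f z‖ ^ 2)
    (hm : ∀ z ∈ ball p r, ballMetric b (f z) (deriv f z) = c * cigar z) {z u : ℂ}
    (hz : z ∈ ball p (r / 4)) (hu : u ∈ ball (conj p) (r / 4)) :
    (1 + z * u) * ((1 + b * ⟪f (conj u), f z⟫_ℂ) * ⟪deriv f (conj u), deriv f z⟫_ℂ -
        b * (⟪deriv f (conj u), f z⟫_ℂ * ⟪f (conj u), deriv f z⟫_ℂ)) =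
      c * (1 + b * ⟪f (conj u), f z⟫_ℂ) ^ 2 := by
  have hf' : DifferentiableOn ℂ (deriv f) (ball p r) := hf.deriv isOpen_ball
  have h00 := differentiableOn_inner_conj hf hf
  have h01 := differentiableOn_inner_conj hf' hf
  have h10 := differentiableOn_inner_conj hf hf'
  have h11 := differentiableOn_inner_conj hf' hf'
  refine eq_of_eq_on_conj_diagonal
    (A := fun q => (1 + q.1 * q.2) * ((1 + b * ⟪f (conj q.2), f q.1⟫_ℂ) *
      ⟪deriv f (conj q.2), deriv f q.1⟫_ℂ -
        b * (⟪deriv f (conj q.2), f q.1⟫_ℂ * ⟪f (conj q.2), deriv f q.1⟫_ℂ)))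
    (B := fun q => c * (1 + b * ⟪f (conj q.2), f q.1⟫_ℂ) ^ 2) hr ?_ ?_ ?_ hz hu
  · fun_prop
  · fun_prop
  intro z hz
  have h := hm z hz
  have hp := hpos z hz
  have hq : (0 : ℝ) < 1 + ‖z‖ ^ 2 := by positivity
  have key : (1 + ‖z‖ ^ 2) * ((1 + b * ‖f z‖ ^ 2) * ‖deriv f z‖ ^ 2 -
      b * ‖⟪f z, deriv f z⟫_ℂ‖ ^ 2) = c * (1 + b * ‖f z‖ ^ 2) ^ 2 := by
    rw [ballMetric, cigar] at h
    field_simp at h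
    linear_combination h
  have e1 : ⟪deriv f z, f z⟫_ℂ * ⟪f z, deriv f z⟫_ℂ = ((‖⟪f z, deriv f z⟫_ℂ‖ ^ 2 : ℝ) : ℂ) := by
    rw [← inner_conj_symm, mul_comm, Complex.mul_conj, Complex.normSq_eq_norm_sq]
  simp only [Complex.conj_conj]
  rw [e1, Complex.mul_conj, Complex.normSq_eq_norm_sq, inner_self_eq_norm_sq_to_K,
    inner_self_eq_norm_sq_to_K]
  have := congrArg (fun x : ℝ => (x : ℂ)) key
  push_cast at this ⊢
  exact this

/-- For `b ≤ 0` the form `A ⟪x, y⟫ - b ⟪x, f⟫ ⟪f, y⟫` with `A = 1 + b‖f‖²` is positive semidefinite.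
The Gram determinant of `f'`, `f''` at `p` is thus non-negative, while the right side of
`gram_identity` is negative. -/
theorem not_ball_immersion_cigar {b c r : ℝ} {p : ℂ} (hb : b ≤ 0) (hc : 0 < c) (hr : 0 < r)
    [CompleteSpace H] {f : ℂ → H} (hf : DifferentiableOn ℂ f (ball p r))
    (hpos : ∀ z ∈ ball p r, 0 < 1 + b * ‖f z‖ ^ 2)
    (hm : ∀ z ∈ ball p r, ballMetric b (f z) (deriv f z) = c * cigar z) : False := by
  set f₁ := deriv f with hf₁
  set f₂ := deriv f₁ with hf₂
  have hd : ∀ z ∈ ball p r, HasDerivAt f (f₁ z) z := fun z hz =>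
    hf.hasDerivAt (isOpen_ball.mem_nhds hz)
  have hd₁ : ∀ z ∈ ball p r, HasDerivAt f₁ (f₂ z) z := fun z hz =>
    (hf.deriv isOpen_ball).hasDerivAt (isOpen_ball.mem_nhds hz)
  have hr4 : (0 : ℝ) < r / 4 := by positivity
  have hsub : ∀ q : ℂ, ball q (r / 4) ⊆ ball q r := fun q => ball_subset_ball (by linarith)
  have H0 : ∀ z ∈ ball p (r / 4), ∀ u ∈ ball (conj p) (r / 4), _ := fun z hz u hu =>
    ball_polarized hr hf hpos hm hz hu
  rw [← hf₁] at H0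
  -- The `z`-derivative of `H0`; `H2` is the `u`-derivative and `H12` the mixed one. Differentiating
  -- `J`, the two terms `b ⟪f, f'⟫ ⟪f', f'⟫` cancel, so each derivative of `J` is again an entry of
  -- the Gram matrix.
  have H1 : ∀ z ∈ ball p (r / 4), ∀ u ∈ ball (conj p) (r / 4),
      u * ((1 + b * ⟪f (conj u), f z⟫_ℂ) * ⟪f₁ (conj u), f₁ z⟫_ℂ -
        b * (⟪f₁ (conj u), f z⟫_ℂ * ⟪f (conj u), f₁ z⟫_ℂ)) +
      (1 + z * u) * ((1 + b * ⟪f (conj u), f z⟫_ℂ) * ⟪f₁ (conj u), f₂ z⟫_ℂ -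
        b * (⟪f₁ (conj u), f z⟫_ℂ * ⟪f (conj u), f₂ z⟫_ℂ)) =
      c * (2 * (1 + b * ⟪f (conj u), f z⟫_ℂ) * (b * ⟪f (conj u), f₁ z⟫_ℂ)) := by
    intro z hz u hu
    have hl := ((((hasDerivAt_id z).mul_const u).const_add 1).mul
      (((((hasDerivAt_inner_right (f (conj u)) (hd z (hsub _ hz))).const_mul (b : ℂ)).const_add
        1).mul (hasDerivAt_inner_right (f₁ (conj u)) (hd₁ z (hsub _ hz)))).sub
      (((hasDerivAt_inner_right (f₁ (conj u)) (hd z (hsub _ hz))).mul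
        (hasDerivAt_inner_right (f (conj u)) (hd₁ z (hsub _ hz)))).const_mul (b : ℂ))))
    have hrr := (((((hasDerivAt_inner_right (f (conj u)) (hd z (hsub _ hz))).const_mul
      (b : ℂ)).const_add 1).pow 2).const_mul (c : ℂ))
    have := hasDerivAt_value_eq hl hrr (isOpen_ball.mem_nhds hz) fun w hw => H0 w hw u hu
    simp only [id, Pi.mul_apply, Pi.sub_apply] at this
    push_cast at this
    linear_combination this
  have hp : p ∈ ball p (r / 4) := mem_ball_self hr4
  have hcp : conj p ∈ ball (conj p) (r / 4) := mem_ball_self hr4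
  have hp' : conj (conj p) ∈ ball p r := by simpa using hr
  have d0 := fun v => hasDerivAt_inner_conj_left v (hd _ hp')
  have d1 := fun v => hasDerivAt_inner_conj_left v (hd₁ _ hp')
  have d00 := d0 (f p)
  have d01 := d0 (f₁ p)
  have d02 := d0 (f₂ p)
  have d10 := d1 (f p)
  have d11 := d1 (f₁ p)
  have d12 := d1 (f₂ p)
  have H2 : p * ((1 + b * ⟪f p, f p⟫_ℂ) * ⟪f₁ p, f₁ p⟫_ℂ -
        b * (⟪f₁ p, f p⟫_ℂ * ⟪f p, f₁ p⟫_ℂ)) +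
      (1 + p * conj p) * ((1 + b * ⟪f p, f p⟫_ℂ) * ⟪f₂ p, f₁ p⟫_ℂ -
        b * (⟪f₂ p, f p⟫_ℂ * ⟪f p, f₁ p⟫_ℂ)) =
      c * (2 * (1 + b * ⟪f p, f p⟫_ℂ) * (b * ⟪f₁ p, f p⟫_ℂ)) := by
    have hl := ((((hasDerivAt_id (conj p)).const_mul p).const_add 1).mul
      ((((d00.const_mul (b : ℂ)).const_add 1).mul d11).sub ((d10.mul d01).const_mul (b : ℂ))))
    have hrr := ((((d00.const_mul (b : ℂ)).const_add 1).pow 2).const_mul (c : ℂ))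
    have := hasDerivAt_value_eq hl hrr (isOpen_ball.mem_nhds hcp) fun w hw => H0 p hp w hw
    simp only [id, Pi.mul_apply, Pi.sub_apply, Complex.conj_conj]
      at this
    push_cast at this
    linear_combination this
  have H12 : ((1 + b * ⟪f p, f p⟫_ℂ) * ⟪f₁ p, f₁ p⟫_ℂ -
        b * (⟪f₁ p, f p⟫_ℂ * ⟪f p, f₁ p⟫_ℂ)) +
      p * ((1 + b * ⟪f p, f p⟫_ℂ) * ⟪f₁ p, f₂ p⟫_ℂ -
        b * (⟪f₁ p, f p⟫_ℂ * ⟪f p, f₂ p⟫_ℂ)) +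
      conj p * ((1 + b * ⟪f p, f p⟫_ℂ) * ⟪f₂ p, f₁ p⟫_ℂ -
        b * (⟪f₂ p, f p⟫_ℂ * ⟪f p, f₁ p⟫_ℂ)) +
      (1 + p * conj p) * ((1 + b * ⟪f p, f p⟫_ℂ) * ⟪f₂ p, f₂ p⟫_ℂ -
        b * (⟪f₂ p, f p⟫_ℂ * ⟪f p, f₂ p⟫_ℂ)) =
      c * (2 * ((b * ⟪f p, f₁ p⟫_ℂ) * (b * ⟪f₁ p, f p⟫_ℂ) +
        (1 + b * ⟪f p, f p⟫_ℂ) * (b * ⟪f₁ p, f₁ p⟫_ℂ))) := by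
    have hl := (((hasDerivAt_id (conj p)).mul
        ((((d00.const_mul (b : ℂ)).const_add 1).mul d11).sub
          ((d10.mul d01).const_mul (b : ℂ)))).add
      ((((hasDerivAt_id (conj p)).const_mul p).const_add 1).mul
        ((((d00.const_mul (b : ℂ)).const_add 1).mul d12).sub
          ((d10.mul d02).const_mul (b : ℂ)))))
    have hrr := (((((d00.const_mul (b : ℂ)).const_add 1).const_mul 2).mul
      (d01.const_mul (b : ℂ))).const_mul (c : ℂ))
    have := hasDerivAt_value_eq hl hrr (isOpen_ball.mem_nhds hcp) fun w hw => H1 p hp w hw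
    simp only [id, Pi.mul_apply, Pi.sub_apply, Complex.conj_conj]
      at this
    linear_combination this
  have H0p := H0 p hp _ hcp
  have H1p := H1 p hp _ hcp
  simp only [Complex.conj_conj] at H0p H1p
  have hA := hpos p (mem_ball_self hr)
  have hX : (0 : ℝ) < 1 + ‖p‖ ^ 2 := by positivity
  have eX : 1 + p * conj p = ((1 + ‖p‖ ^ 2 : ℝ) : ℂ) := by
    rw [Complex.mul_conj, Complex.normSq_eq_norm_sq]; push_cast; ring
  have eA : 1 + (b : ℂ) * ⟪f p, f p⟫_ℂ = ((1 + b * ‖f p‖ ^ 2 : ℝ) : ℂ) := by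
    rw [inner_self_eq_norm_sq_to_K]; push_cast; rfl
  have key := gram_identity rfl (by rw [eX]; exact_mod_cast hX.ne')
    (by rw [eA]; exact_mod_cast hA.ne') H0p H1p H2 H12 (b := (b : ℂ)) (by ring)
  have cs := norm_sq_inner_add_mul_le hA.le (neg_nonneg.2 hb) (f p) (f₁ p) (f₂ p)
  have ej : ∀ v : H, (1 + b * ⟪f p, f p⟫_ℂ) * ⟪v, v⟫_ℂ - b * (⟪v, f p⟫_ℂ * ⟪f p, v⟫_ℂ) =
      (((1 + b * ‖f p‖ ^ 2) * ‖v‖ ^ 2 + -b * ‖⟪f p, v⟫_ℂ‖ ^ 2 : ℝ) : ℂ) := by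
    intro v
    have e1 : ⟪v, f p⟫_ℂ * ⟪f p, v⟫_ℂ = ((‖⟪f p, v⟫_ℂ‖ ^ 2 : ℝ) : ℂ) := by
      rw [← inner_conj_symm, mul_comm, Complex.mul_conj, Complex.normSq_eq_norm_sq]
    rw [e1, eA, inner_self_eq_norm_sq_to_K]
    push_cast
    simp only [Complex.coe_algebraMap]
    ring
  have e12 : ((1 + b * ⟪f p, f p⟫_ℂ) * ⟪f₁ p, f₂ p⟫_ℂ - b * (⟪f₁ p, f p⟫_ℂ * ⟪f p, f₂ p⟫_ℂ)) *
      ((1 + b * ⟪f p, f p⟫_ℂ) * ⟪f₂ p, f₁ p⟫_ℂ - b * (⟪f₂ p, f p⟫_ℂ * ⟪f p, f₁ p⟫_ℂ)) =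
      ((‖((1 + b * ‖f p‖ ^ 2 : ℝ) : ℂ) * ⟪f₁ p, f₂ p⟫_ℂ +
        (-b : ℝ) * (⟪f₁ p, f p⟫_ℂ * ⟪f p, f₂ p⟫_ℂ)‖ ^ 2 : ℝ) : ℂ) := by
    rw [← Complex.normSq_eq_norm_sq, ← Complex.mul_conj, eA]
    simp only [map_add, map_mul, inner_conj_symm, Complex.conj_ofReal]
    push_cast
    ring
  rw [e12, ej, ej, eX, eA] at key
  have key' := congrArg Complex.re key
  norm_cast at key'
  have h4 : 0 < (1 + b * ‖f p‖ ^ 2) ^ 4 := by positivity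
  have h5 : 2 * b * c ^ 3 * (1 + ‖p‖ ^ 2) ≤ 0 := by
    have : 0 ≤ c ^ 3 * (1 + ‖p‖ ^ 2) := by positivity
    nlinarith
  have h6 : 0 < c ^ 2 := by positivity
  have h7 : (2 * b * c ^ 3 * (1 + ‖p‖ ^ 2) - c ^ 2) * (1 + b * ‖f p‖ ^ 2) ^ 4 < 0 :=
    mul_neg_of_neg_of_pos (by linarith) h4
  have h8 := mul_nonneg (pow_nonneg hX.le 4) (sub_nonneg.2 cs)
  push_cast at key' h8
  linarith

end Ball

/-! ### Positive definite functions of `z + w̄` -/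

theorem differentiableOn_iteratedDeriv {E : Type*} [NormedAddCommGroup E] [NormedSpace ℂ E]
    [CompleteSpace E] {f : ℂ → E} {S : Set ℂ} (hS : IsOpen S) (hf : DifferentiableOn ℂ f S)
    (n : ℕ) : DifferentiableOn ℂ (iteratedDeriv n f) S := by
  induction n with
  | zero => simpa using hf
  | succ n ih => rw [iteratedDeriv_succ]; exact ih.deriv hS

theorem add_mem_ball_zero {z u : ℂ} {r : ℝ} (hz : z ∈ ball (0 : ℂ) r) (hu : u ∈ ball (0 : ℂ) r) :
    z + u ∈ ball (0 : ℂ) (2 * r) := by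
  rw [mem_ball_zero_iff] at *
  linarith [norm_add_le z u]

section Proj

variable {H : Type*} [NormedAddCommGroup H] [InnerProductSpace ℂ H] [CompleteSpace H]

theorem inner_iteratedDeriv_of_inner_eq {G : ℂ → H} {γ : ℂ → ℂ} {r : ℝ}
    (hG : DifferentiableOn ℂ G (ball 0 r)) (hγ : DifferentiableOn ℂ γ (ball 0 (2 * r)))
    (h : ∀ z ∈ ball (0 : ℂ) r, ∀ w ∈ ball (0 : ℂ) r, ⟪G w, G z⟫_ℂ = γ (z + conj w)) (j k : ℕ) :
    ∀ z ∈ ball (0 : ℂ) r, ∀ w ∈ ball (0 : ℂ) r,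
      ⟪iteratedDeriv j G w, iteratedDeriv k G z⟫_ℂ = iteratedDeriv (j + k) γ (z + conj w) := by
  have dG : ∀ n, ∀ z ∈ ball (0 : ℂ) r,
      HasDerivAt (iteratedDeriv n G) (iteratedDeriv (n + 1) G z) z := fun n z hz => by
    rw [iteratedDeriv_succ]
    exact (differentiableOn_iteratedDeriv isOpen_ball hG n).hasDerivAt (isOpen_ball.mem_nhds hz)
  have dγ : ∀ n, ∀ z ∈ ball (0 : ℂ) (2 * r),
      HasDerivAt (iteratedDeriv n γ) (iteratedDeriv (n + 1) γ z) z := fun n z hz => by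
    rw [iteratedDeriv_succ]
    exact (differentiableOn_iteratedDeriv isOpen_ball hγ n).hasDerivAt (isOpen_ball.mem_nhds hz)
  have hc : ∀ w ∈ ball (0 : ℂ) r, conj w ∈ ball (0 : ℂ) r := fun w hw => by
    rw [conj_mem_ball]; simpa using hw
  induction j with
  | zero =>
    induction k with
    | zero => simpa using h
    | succ k ih =>
      intro z hz w hw
      refine hasDerivAt_value_eq (hasDerivAt_inner_right (iteratedDeriv 0 G w) (dG k z hz))
        ?_ (isOpen_ball.mem_nhds hz) fun x hx => ih x hx w hw
      exact (dγ (0 + k) _ (add_mem_ball_zero hz (hc w hw))).comp_add_const z (conj w)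
  | succ j ih =>
    intro z hz w hw
    have hw' : conj (conj w) ∈ ball (0 : ℂ) r := by simpa using hw
    have := hasDerivAt_value_eq (hasDerivAt_inner_conj_left (iteratedDeriv k G z) (dG j _ hw'))
      ((dγ (j + k) _ (add_mem_ball_zero hz (hc w hw))).comp_const_add z (conj w))
      (isOpen_ball.mem_nhds (hc w hw)) fun x hx => by
        have := ih z hz (conj x) (hc x hx)
        rwa [Complex.conj_conj] at this
    rw [Complex.conj_conj] at this
    rw [this, add_right_comm]

/-- The Cauchy-Schwarz inequality bounds the derivatives of a positive definite function off the
real axis by those on the real axis. -/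
theorem norm_iteratedDeriv_sq_le_of_inner_eq {G : ℂ → H} {γ : ℂ → ℂ} {r : ℝ} (hr : 0 < r)
    (hG : DifferentiableOn ℂ G (ball 0 r)) (hγ : DifferentiableOn ℂ γ (ball 0 (2 * r)))
    (h : ∀ z ∈ ball (0 : ℂ) r, ∀ w ∈ ball (0 : ℂ) r, ⟪G w, G z⟫_ℂ = γ (z + conj w)) (j k : ℕ)
    {y : ℝ} (hy : |y| < r) :
    ‖iteratedDeriv (j + k) γ (y * Complex.I)‖ ^ 2 ≤
      ‖iteratedDeriv (j + j) γ 0‖ * ‖iteratedDeriv (k + k) γ 0‖ := by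
  have h0 : (0 : ℂ) ∈ ball (0 : ℂ) r := mem_ball_self hr
  have hyI : (y * Complex.I : ℂ) ∈ ball (0 : ℂ) r := by simpa using hy
  have e := inner_iteratedDeriv_of_inner_eq hG hγ h
  -- Since `z + z̄ = 0` on the imaginary axis, both diagonal entries, at `0` and at `i y`, are
  -- derivatives of `γ` at `0`; only the off-diagonal one sees `i y`.
  have e1 := e j k _ hyI _ h0
  have e2 := e j j _ h0 _ h0
  have e3 := e k k _ hyI _ hyI
  simp only [map_zero, add_zero, map_mul, Complex.conj_ofReal, Complex.conj_I, mul_neg,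
    add_neg_cancel] at e1 e2 e3
  rw [← e1, ← e2, ← e3]
  have cs := norm_inner_le_norm (𝕜 := ℂ) (iteratedDeriv j G 0) (iteratedDeriv k G (y * Complex.I))
  have en : ∀ v : H, ‖⟪v, v⟫_ℂ‖ = ‖v‖ ^ 2 := fun v => by rw [inner_self_eq_norm_sq_to_K]; simp
  rw [en, en]
  calc _ ≤ (‖iteratedDeriv j G 0‖ * ‖iteratedDeriv k G (y * Complex.I)‖) ^ 2 := by gcongr
    _ = _ := by ring

theorem log_hessian_polarized {r : ℝ} (hr : 0 < r) {F : ℂ → H} {h : ℂ → ℂ}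
    (hF : DifferentiableOn ℂ F (ball 0 r)) (hh : DifferentiableOn ℂ h (ball 0 (2 * r)))
    (hm : ∀ z ∈ ball (0 : ℂ) r, ((‖F z‖ ^ 2 * ‖deriv F z‖ ^ 2 - ‖⟪F z, deriv F z⟫_ℂ‖ ^ 2 : ℝ) : ℂ) =
      h (z + conj z) * ((‖F z‖ ^ 4 : ℝ) : ℂ)) {z u : ℂ}
    (hz : z ∈ ball (0 : ℂ) (r / 4)) (hu : u ∈ ball (0 : ℂ) (r / 4)) :
    ⟪F (conj u), F z⟫_ℂ * ⟪deriv F (conj u), deriv F z⟫_ℂ -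
        ⟪deriv F (conj u), F z⟫_ℂ * ⟪F (conj u), deriv F z⟫_ℂ =
      h (z + u) * ⟪F (conj u), F z⟫_ℂ ^ 2 := by
  have hF' : DifferentiableOn ℂ (deriv F) (ball 0 r) := hF.deriv isOpen_ball
  have h00 := differentiableOn_inner_conj hF hF
  have h01 := differentiableOn_inner_conj hF' hF
  have h10 := differentiableOn_inner_conj hF hF'
  have h11 := differentiableOn_inner_conj hF' hF'
  have hs : DifferentiableOn ℂ (fun q : ℂ × ℂ => h (q.1 + q.2))
      (ball (0 : ℂ) r ×ˢ ball (conj 0) r) := by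
    refine hh.comp (by fun_prop) fun q hq => add_mem_ball_zero hq.1 ?_
    simpa using hq.2
  refine eq_of_eq_on_conj_diagonal
    (A := fun q => ⟪F (conj q.2), F q.1⟫_ℂ * ⟪deriv F (conj q.2), deriv F q.1⟫_ℂ -
        ⟪deriv F (conj q.2), F q.1⟫_ℂ * ⟪F (conj q.2), deriv F q.1⟫_ℂ)
    (B := fun q => h (q.1 + q.2) * ⟪F (conj q.2), F q.1⟫_ℂ ^ 2) hr ?_ ?_ ?_ hz (by simpa using hu)
  · fun_prop
  · exact hs.mul (h00.pow 2)
  intro z hz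
  have key := hm z hz
  have e1 : ⟪deriv F z, F z⟫_ℂ * ⟪F z, deriv F z⟫_ℂ = ((‖⟪F z, deriv F z⟫_ℂ‖ ^ 2 : ℝ) : ℂ) := by
    rw [← inner_conj_symm, mul_comm, Complex.mul_conj, Complex.normSq_eq_norm_sq]
  simp only [Complex.conj_conj]
  rw [e1, inner_self_eq_norm_sq_to_K, inner_self_eq_norm_sq_to_K]
  push_cast at key ⊢
  simp only [Complex.coe_algebraMap]
  linear_combination key

theorem eq_of_hasDerivAt_zero_ball {f : ℂ → ℂ} {r : ℝ} (hf : ∀ z ∈ ball (0 : ℂ) r, HasDerivAt f 0 z)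
    {z w : ℂ} (hz : z ∈ ball (0 : ℂ) r) (hw : w ∈ ball (0 : ℂ) r) : f z = f w :=
  isOpen_ball.is_const_of_deriv_eq_zero (convex_ball (0 : ℂ) r).isPreconnected
    (fun x hx => (hf x hx).differentiableAt.differentiableWithinAt) (fun x hx => (hf x hx).deriv)
    hz hw

/-- If `∂∂̄ log ‖F‖² = μ ψ''(z + z̄)`, then, after multiplication of `F` by a holomorphic function,
`⟪F w, F z⟫ = exp (μ ψ (z + w̄))`. -/
theorem exists_inner_eq_exp {r μ : ℝ} (hr : 0 < r) {F : ℂ → H} {ψ ψ₁ h : ℂ → ℂ}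
    (hF : DifferentiableOn ℂ F (ball 0 r)) (hF0 : F 0 ≠ 0)
    (hψ : ∀ s ∈ ball (0 : ℂ) (2 * r), HasDerivAt ψ (ψ₁ s) s)
    (hψ₁ : ∀ s ∈ ball (0 : ℂ) (2 * r), HasDerivAt ψ₁ (h s) s)
    (hψc : ∀ s ∈ ball (0 : ℂ) (2 * r), ψ (conj s) = conj (ψ s))
    (hh : DifferentiableOn ℂ h (ball 0 (2 * r)))
    (hm : ∀ z ∈ ball (0 : ℂ) r, ((‖F z‖ ^ 2 * ‖deriv F z‖ ^ 2 - ‖⟪F z, deriv F z⟫_ℂ‖ ^ 2 : ℝ) : ℂ) =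
      μ * h (z + conj z) * ((‖F z‖ ^ 4 : ℝ) : ℂ)) :
    ∃ r' > 0, r' ≤ r ∧ ∃ G : ℂ → H, DifferentiableOn ℂ G (ball 0 r') ∧
      ∀ z ∈ ball (0 : ℂ) r', ∀ w ∈ ball (0 : ℂ) r',
        ⟪G w, G z⟫_ℂ = Complex.exp (μ * ψ (z + conj w)) := by
  obtain ⟨r₁, hr₁, hB⟩ : ∃ r₁ > 0, ∀ z ∈ ball (0 : ℂ) r₁, ∀ u ∈ ball (0 : ℂ) r₁,
      ⟪F (conj u), F z⟫_ℂ ≠ 0 := by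
    have hc := (differentiableOn_inner_conj hF hF).continuousOn.continuousAt
      (x := ((0 : ℂ), (0 : ℂ)))
      (prod_mem_nhds (ball_mem_nhds 0 hr) (by rw [map_zero]; exact ball_mem_nhds 0 hr))
    have hne := hc.eventually_ne (show ⟪F (conj 0), F 0⟫_ℂ ≠ 0 by simpa using hF0)
    obtain ⟨ε, hε, hb⟩ := Metric.eventually_nhds_iff_ball.1 hne
    refine ⟨ε, hε, fun z hz u hu => hb (z, u) ?_⟩
    rw [← ball_prod_same]
    exact ⟨hz, hu⟩
  set r' := min r₁ (r / 4) with hr'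
  have hr'0 : 0 < r' := lt_min hr₁ (by positivity)
  have hr'r : r' ≤ r := (min_le_right _ _).trans (by linarith)
  have s1 : ball (0 : ℂ) r' ⊆ ball 0 r₁ := ball_subset_ball (min_le_left _ _)
  have s4 : ball (0 : ℂ) r' ⊆ ball 0 (r / 4) := ball_subset_ball (min_le_right _ _)
  have sr : ball (0 : ℂ) r' ⊆ ball 0 r := ball_subset_ball hr'r
  have s2 : ∀ z ∈ ball (0 : ℂ) r', ∀ u ∈ ball (0 : ℂ) r', z + u ∈ ball (0 : ℂ) (2 * r) :=
    fun z hz u hu => add_mem_ball_zero (sr hz) (sr hu)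
  have hcj : ∀ w ∈ ball (0 : ℂ) r', conj w ∈ ball (0 : ℂ) r' := fun w hw => by
    rw [conj_mem_ball]; simpa using hw
  have h0 : (0 : ℂ) ∈ ball (0 : ℂ) r' := mem_ball_self hr'0
  have dF : ∀ z ∈ ball (0 : ℂ) r', HasDerivAt F (deriv F z) z := fun z hz =>
    hF.hasDerivAt (isOpen_ball.mem_nhds (sr hz))
  -- This is `∂/∂u` of `log ⟪F ū, F z⟫ - μ ψ (z + u)`. Its `z`-derivative vanishes by
  -- `log_hessian_polarized`, so it depends on `u` alone.
  set β : ℂ → ℂ → ℂ := fun z u =>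
    ⟪deriv F (conj u), F z⟫_ℂ / ⟪F (conj u), F z⟫_ℂ - μ * ψ₁ (z + u) with hβ
  have hβc : ∀ z ∈ ball (0 : ℂ) r', ∀ u ∈ ball (0 : ℂ) r', β z u = β 0 u := by
    intro z hz u hu
    refine eq_of_hasDerivAt_zero_ball (f := fun z => β z u) (fun x hx => ?_) hz h0
    have hne := hB x (s1 hx) u (s1 hu)
    have := (((hasDerivAt_inner_right (deriv F (conj u)) (dF x hx)).div
      (hasDerivAt_inner_right (F (conj u)) (dF x hx)) hne).sub
      (((hψ₁ _ (s2 x hx u hu)).comp_add_const x u).const_mul (μ : ℂ)))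
    refine this.congr_deriv ?_
    have e := log_hessian_polarized hr hF (h := fun s => μ * h s) (hh.const_mul _) hm
      (s4 hx) (s4 hu)
    field_simp
    linear_combination e
  -- The ratio of the actual kernel to the desired one. Its logarithmic `u`-derivative is
  -- independent of `z`, so `Q` is a product of a function of `z` and one of `u`. Working with `Q`
  -- avoids choosing a logarithm.
  set Q : ℂ → ℂ → ℂ := fun z u => ⟪F (conj u), F z⟫_ℂ * Complex.exp (-(μ * ψ (z + u))) with hQ
  have hQ0 : ∀ z ∈ ball (0 : ℂ) r', ∀ u ∈ ball (0 : ℂ) r', Q z u ≠ 0 := fun z hz u hu =>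
    mul_ne_zero (hB z (s1 hz) u (s1 hu)) (Complex.exp_ne_zero _)
  have dQ : ∀ z ∈ ball (0 : ℂ) r', ∀ u ∈ ball (0 : ℂ) r', HasDerivAt (Q z) (β 0 u * Q z u) u := by
    intro z hz u hu
    have hne := hB z (s1 hz) u (s1 hu)
    have := (hasDerivAt_inner_conj_left (F z) (dF _ (hcj u hu))).mul
      ((((hψ _ (s2 z hz u hu)).comp_const_add z u).const_mul (μ : ℂ)).neg.cexp)
    refine this.congr_deriv ?_
    rw [← hβc z hz u hu]
    simp only [hβ, hQ, Pi.neg_apply]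
    field_simp
    ring
  have hQp : ∀ z ∈ ball (0 : ℂ) r', ∀ u ∈ ball (0 : ℂ) r', Q z u * Q 0 0 = Q z 0 * Q 0 u := by
    intro z hz u hu
    have := eq_of_hasDerivAt_zero_ball (f := fun u => Q z u / Q 0 u) (r := r') (fun x hx => by
      have := (dQ z hz x hx).div (dQ 0 h0 x hx) (hQ0 0 h0 x hx)
      refine this.congr_deriv ?_
      rw [div_eq_zero_iff]
      left; ring) hu h0
    rwa [div_eq_div_iff (hQ0 0 h0 u hu) (hQ0 0 h0 0 h0)] at this
  have hQs : ∀ w ∈ ball (0 : ℂ) r', conj (Q w 0) = Q 0 (conj w) := by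
    intro w hw
    have hw2 : w ∈ ball (0 : ℂ) (2 * r) := by simpa using s2 w hw 0 h0
    simp only [hQ, map_mul, ← Complex.exp_conj, map_neg, Complex.conj_ofReal, inner_conj_symm,
      add_zero, zero_add, map_zero, Complex.conj_conj, hψc w hw2]
  have hψ0 : conj (ψ 0) = ψ 0 := by
    rw [← hψc 0 (by simpa using s2 0 h0 0 h0), map_zero]
  obtain ⟨x0, hx0⟩ := Complex.conj_eq_iff_real.1 hψ0
  set q0 : ℝ := ‖F 0‖ ^ 2 * Real.exp (-(μ * x0)) with hq0
  have hq0p : 0 < q0 := mul_pos (pow_pos (norm_pos_iff.2 hF0) 2) (Real.exp_pos _)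
  have eQ0 : Q 0 0 = q0 := by
    simp only [hQ, hq0, map_zero, add_zero, hx0, inner_self_eq_norm_sq_to_K]
    push_cast
    rfl
  -- Since `conj (Q w 0) = Q 0 w̄`, this factor multiplies the kernel by `Q 0 0 / (Q z 0 * Q 0 w̄) =
  -- 1 / Q z w̄`. The square root needs `Q 0 0 = q0` to be real and positive, which holds because `ψ
  -- 0` is real.
  refine ⟨r', hr'0, hr'r, fun z => ((Real.sqrt q0 : ℂ) / Q z 0) • F z, ?_, ?_⟩
  · have d1 : DifferentiableOn ℂ (fun z => Q z 0) (ball 0 r') := by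
      intro z hz
      have d2 := (hasDerivAt_inner_right (F (conj 0)) (dF z hz)).mul
        (((((hψ _ (s2 z hz 0 h0)).comp_add_const z 0).const_mul (μ : ℂ)).neg.cexp))
      exact d2.differentiableAt.differentiableWithinAt
    exact ((differentiableOn_const _).div d1 fun z hz => hQ0 z hz 0 h0).smul (hF.mono sr)
  · intro z hz w hw
    have hn := hQ0 z hz 0 h0
    have hn2 := hQ0 0 h0 _ (hcj w hw)
    rw [inner_smul_left, inner_smul_right, map_div₀, Complex.conj_ofReal, hQs w hw]
    have e1 := hQp z hz _ (hcj w hw)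
    have e2 : ⟪F w, F z⟫_ℂ = Q z (conj w) * Complex.exp (μ * ψ (z + conj w)) := by
      simp only [hQ, Complex.conj_conj]
      rw [mul_assoc, ← Complex.exp_add]
      simp
    have e3 : (Real.sqrt q0 : ℂ) * (Real.sqrt q0 : ℂ) = Q 0 0 := by
      rw [eQ0, ← Complex.ofReal_mul, Real.mul_self_sqrt hq0p.le]
    rw [e2]
    field_simp
    rw [sq, e3]
    linear_combination e1

end Proj

/-! ### Singularities of the logarithmic equation -/

section Singularity

/-- The Euler operator `(z - s) d/dz` preserves the factor `(z - s) ^ n`, so it can be iterated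
without the exponent `n - 1`, which truncates at `n = 0`. -/
theorem eventually_sub_mul_deriv_eq {f g : ℂ → ℂ} {s : ℂ} {n : ℕ} (hg : AnalyticAt ℂ g s)
    (h : ∀ᶠ z in 𝓝 s, f z = (z - s) ^ n * g z) :
    ∀ᶠ z in 𝓝 s, (z - s) * deriv f z = (z - s) ^ n * (n * g z + (z - s) * deriv g z) := by
  filter_upwards [h.eventually_nhds, hg.eventually_analyticAt] with z hz hgz
  have h1 : HasDerivAt (fun z => (z - s) ^ n * g z)
      (n * (z - s) ^ (n - 1) * 1 * g z + (z - s) ^ n * deriv g z) z :=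
    (((hasDerivAt_id z).sub_const s).pow n).mul hgz.differentiableAt.hasDerivAt
  rw [EventuallyEq.deriv_eq hz, h1.deriv]
  rcases n with _ | n
  · simp
  · simp only [Nat.add_sub_cancel]
    ring

/-- The equation `(log Γ)'' = μ P eᶻ / (1 + P eᶻ)` has no holomorphic solution `Γ` at a zero of
`1 + P eᶻ`. -/
theorem not_analyticAt_of_log_ode {Γ : ℂ → ℂ} {s P μ : ℂ} (hΓ : AnalyticAt ℂ Γ s)
    (hne : ¬∀ᶠ z in 𝓝 s, Γ z = 0) (hs : 1 + P * Complex.exp s = 0) (hμ : μ ≠ 0)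
    (ode : ∀ᶠ z in 𝓝 s, (1 + P * Complex.exp z) * (deriv (deriv Γ) z * Γ z - deriv Γ z ^ 2) =
      μ * (P * Complex.exp z) * Γ z ^ 2) : False := by
  have hPs : P * Complex.exp s = -1 := by linear_combination hs
  obtain ⟨n, v, hv, hvs, hΓv⟩ := hΓ.exists_eventuallyEq_pow_smul_nonzero_iff.2 hne
  simp only [smul_eq_mul] at hΓv
  set a : ℂ → ℂ := fun z => n * v z + (z - s) * deriv v z with ha
  have haa : AnalyticAt ℂ a s := by
    have := hv.deriv
    fun_prop
  have h1 := eventually_sub_mul_deriv_eq hv hΓv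
  have h2 := eventually_sub_mul_deriv_eq (f := fun z => (z - s) * deriv Γ z) haa h1
  set k : ℂ → ℂ := dslope (fun z => 1 + P * Complex.exp z) s with hk
  have hd : ∀ z, HasDerivAt (fun z => 1 + P * Complex.exp z) (P * Complex.exp z) z := fun z =>
    ((Complex.hasDerivAt_exp z).const_mul P).const_add 1
  have hkc : ContinuousAt k s := continuousAt_dslope_same.2 (hd s).differentiableAt
  have hks : k s = -1 := by rw [hk, dslope_same, (hd s).deriv, hPs]
  have hkx : ∀ z, 1 + P * Complex.exp z = (z - s) * k z := fun z => by
    have := sub_smul_dslope (fun z => 1 + P * Complex.exp z) s z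
    simp only [smul_eq_mul, hs, sub_zero] at this
    exact this.symm
  -- The equation for `Γ = (z - s) ^ n v`, multiplied by `z - s` and cleared of `(z - s) ^ (2n +
  -- 1)`; the cancellation is legitimate off `s`, and continuity then gives its value at `s`.
  have key : ∀ᶠ z in 𝓝[≠] s,
      k z * ((n * a z + (z - s) * deriv a z - a z) * v z - a z ^ 2) =
        (z - s) * (μ * (P * Complex.exp z) * v z ^ 2) := by
    filter_upwards [self_mem_nhdsWithin, nhdsWithin_le_nhds ode, nhdsWithin_le_nhds hΓv,
      nhdsWithin_le_nhds h1, nhdsWithin_le_nhds h2,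
      nhdsWithin_le_nhds hΓ.eventually_analyticAt] with z hz e0 eΓ e1 e2 hΓz
    have hx : z - s ≠ 0 := sub_ne_zero.2 hz
    have hdd : deriv (fun z => (z - s) * deriv Γ z) z =
        1 * deriv Γ z + (z - s) * deriv (deriv Γ) z :=
      (((hasDerivAt_id z).sub_const s).mul hΓz.deriv.differentiableAt.hasDerivAt).deriv
    rw [hdd] at e2
    rw [hkx] at e0
    have e3 : (z - s) ^ 2 * deriv (deriv Γ) z =
        (z - s) ^ n * (n * a z + (z - s) * deriv a z - a z) := by
      linear_combination e2 - e1
    have hxn : (z - s) ^ (2 * n + 1) ≠ 0 := pow_ne_zero _ hx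
    apply mul_left_cancel₀ hxn
    calc _ = (z - s) * k z * (((z - s) ^ n * (n * a z + (z - s) * deriv a z - a z)) *
          ((z - s) ^ n * v z) - ((z - s) ^ n * a z) ^ 2) := by ring
      _ = (z - s) * k z * (((z - s) ^ 2 * deriv (deriv Γ) z) * Γ z -
          ((z - s) * deriv Γ z) ^ 2) := by rw [e3, ← eΓ, ← e1]
      _ = (z - s) ^ 2 * (μ * (P * Complex.exp z) * Γ z ^ 2) := by rw [← e0]; ring
      _ = _ := by rw [eΓ]; ring
  have cv := hv.continuousAt
  have ca := haa.continuousAt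
  have cda := haa.deriv.continuousAt
  have hl : ContinuousAt (fun z =>
      k z * ((n * a z + (z - s) * deriv a z - a z) * v z - a z ^ 2)) s := by fun_prop
  have hr : ContinuousAt (fun z => (z - s) * (μ * (P * Complex.exp z) * v z ^ 2)) s := by fun_prop
  have heq := tendsto_nhds_unique ((hl.tendsto.mono_left nhdsWithin_le_nhds).congr' key)
    (hr.tendsto.mono_left (nhdsWithin_le_nhds (s := {s}ᶜ)))
  simp only [hks, ha, sub_self, zero_mul, add_zero] at heq
  -- At `s` one has `a = n v` and `k = -1`. The remaining coefficient `n` is that of the double pole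
  -- `-n / (z - s)²` of `(log Γ)''`, for which the right side has no match. So `Γ s ≠ 0`, and the
  -- original equation at `s` reads `0 = -μ (Γ s)²`.
  have hn : (n : ℂ) * v s ^ 2 = 0 := by linear_combination heq
  have hn0 : n = 0 := by
    have := (mul_eq_zero.1 hn).resolve_right (pow_ne_zero 2 hvs)
    exact_mod_cast this
  have e0 := ode.self_of_nhds
  have eΓ := hΓv.self_of_nhds
  rw [hn0, pow_zero, one_mul] at eΓ
  rw [hs, hPs, eΓ, zero_mul] at e0
  have : μ * v s ^ 2 = 0 := by linear_combination e0
  exact mul_ne_zero hμ (pow_ne_zero 2 hvs) this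

end Singularity

/-! ### Analytic continuation along the imaginary direction -/

section Proj

variable {H : Type*} [NormedAddCommGroup H] [InnerProductSpace ℂ H] [CompleteSpace H]

/-- If `γ (z + w̄)` is positive definite near `0` and `γ` is holomorphic on the disc of radius `R`
around `0`, then `γ` extends from a neighbourhood of `i y` to the discs of radius `ρ < R` around
`i y`. -/
theorem exists_continuation_of_inner_eq {G : ℂ → H} {γ : ℂ → ℂ} {r R ρ y : ℝ} (hr : 0 < r)
    (hrR : 2 * r ≤ R) (hG : DifferentiableOn ℂ G (ball 0 r)) (hγ : DifferentiableOn ℂ γ (ball 0 R))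
    (h : ∀ z ∈ ball (0 : ℂ) r, ∀ w ∈ ball (0 : ℂ) r, ⟪G w, G z⟫_ℂ = γ (z + conj w))
    (hy : |y| < r) (hρ0 : 0 < ρ) (hρ : ρ < R) :
    ∃ Γ : ℂ → ℂ, DifferentiableOn ℂ Γ (ball (y * Complex.I) ρ) ∧
      Γ =ᶠ[𝓝 (y * Complex.I)] γ := by
  obtain ⟨ρ', hρ', hρ'R⟩ := exists_between hρ
  have hρ'0 : 0 < ρ' := hρ0.trans hρ'
  have hsub : closedBall (0 : ℂ) ρ' ⊆ ball 0 R := closedBall_subset_ball hρ'R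
  obtain ⟨M, hM⟩ := (isCompact_closedBall (0 : ℂ) ρ').exists_bound_of_continuousOn
    (hγ.continuousOn.mono hsub)
  have hM0 : 0 ≤ M := (norm_nonneg _).trans (hM 0 (mem_closedBall_self hρ'0.le))
  have hcauchy : ∀ n, ‖iteratedDeriv n γ 0‖ ≤ n.factorial * M / ρ' ^ n := fun n =>
    Complex.norm_iteratedDeriv_le_of_forall_mem_sphere_norm_le n hρ'0
      ((hγ.mono hsub).diffContOnCl_ball subset_rfl) fun z hz => hM z (sphere_subset_closedBall hz)
  have hbound : ∀ n, ‖iteratedDeriv n γ (y * Complex.I)‖ ≤ (n + 1).factorial * M / ρ' ^ n := by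
    intro n
    -- The most balanced splitting bounds both factorials by `(n + 1)!`, while the powers of `ρ'`
    -- still combine to `ρ' ^ (2n)`. The extra factor `n + 1` does not change the radius of
    -- convergence.
    obtain ⟨j, k, rfl, hj, hk⟩ : ∃ j k, n = j + k ∧ j + j ≤ n + 1 ∧ k + k ≤ n + 1 :=
      ⟨n / 2, n - n / 2, by omega, by omega, by omega⟩
    have hcs := norm_iteratedDeriv_sq_le_of_inner_eq hr hG
      (hγ.mono (ball_subset_ball hrR)) h j k hy
    refine le_of_sq_le_sq ?_ (by positivity)
    refine hcs.trans ?_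
    have e1 := hcauchy (j + j)
    have e2 := hcauchy (k + k)
    have f1 : ((j + j).factorial : ℝ) ≤ (j + k + 1).factorial := by
      exact_mod_cast Nat.factorial_le hj
    have f2 : ((k + k).factorial : ℝ) ≤ (j + k + 1).factorial := by
      exact_mod_cast Nat.factorial_le hk
    calc _ ≤ ((j + j).factorial * M / ρ' ^ (j + j)) * ((k + k).factorial * M / ρ' ^ (k + k)) := by
          gcongr
      _ ≤ ((j + k + 1).factorial * M / ρ' ^ (j + j)) *
          ((j + k + 1).factorial * M / ρ' ^ (k + k)) := by gcongr
      _ = _ := by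
        field_simp
        ring
  have hterm : ∀ (n : ℕ), ∀ s ∈ ball (y * Complex.I : ℂ) ρ,
      ‖(n.factorial : ℂ)⁻¹ • (s - y * Complex.I) ^ n • iteratedDeriv n γ (y * Complex.I)‖ ≤
        M * ((n + 1) * (ρ / ρ') ^ n) := by
    intro n s hs
    rw [mem_ball, dist_eq_norm] at hs
    rw [norm_smul, norm_smul, norm_inv, norm_pow, Complex.norm_natCast]
    have hf : (0 : ℝ) < n.factorial := by exact_mod_cast n.factorial_pos
    calc _ ≤ (n.factorial : ℝ)⁻¹ * (ρ ^ n * ((n + 1).factorial * M / ρ' ^ n)) := by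
          gcongr
          exact hbound n
      _ = _ := by
        rw [Nat.factorial_succ, div_pow]
        push_cast
        field_simp
  have hq : ρ / ρ' < 1 := (div_lt_one hρ'0).2 hρ'
  have hq0 : 0 ≤ ρ / ρ' := by positivity
  have hsum : Summable fun n : ℕ => M * ((n + 1) * (ρ / ρ') ^ n) := by
    refine Summable.mul_left M ?_
    simp only [add_mul, one_mul]
    refine Summable.add ?_ (summable_geometric_of_lt_one hq0 hq)
    simpa using summable_pow_mul_geometric_of_norm_lt_one (R := ℝ) 1
      (by rwa [Real.norm_of_nonneg hq0])
  refine ⟨fun s => ∑' n : ℕ, (n.factorial : ℂ)⁻¹ • (s - y * Complex.I) ^ n •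
    iteratedDeriv n γ (y * Complex.I), ?_, ?_⟩
  · refine Complex.differentiableOn_tsum_of_summable_norm hsum (fun n => ?_) isOpen_ball hterm
    fun_prop
  · have hy2 : (y * Complex.I : ℂ) ∈ ball (0 : ℂ) R := by
      simp only [mem_ball_zero_iff, norm_mul, Complex.norm_real, Complex.norm_I, mul_one,
        Real.norm_eq_abs]
      linarith [abs_nonneg y]
    obtain ⟨ε, hε, hb⟩ := Metric.isOpen_ball.mem_nhds hy2 |> Metric.mem_nhds_iff.1
    filter_upwards [ball_mem_nhds (y * Complex.I : ℂ) hε] with s hs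
    exact (Complex.hasSum_taylorSeries_on_ball (hγ.mono hb) hs).tsum_eq

end Proj

/-- A second primitive, real on the real axis, of a holomorphic function real on the real axis. -/
theorem exists_second_primitive_conj {h : ℂ → ℂ} {R : ℝ} (hh : DifferentiableOn ℂ h (ball 0 R))
    (hc : ∀ s, h (conj s) = conj (h s)) :
    ∃ ψ ψ₁ : ℂ → ℂ, (∀ s ∈ ball (0 : ℂ) R, HasDerivAt ψ (ψ₁ s) s) ∧
      (∀ s ∈ ball (0 : ℂ) R, HasDerivAt ψ₁ (h s) s) ∧ ∀ s, ψ (conj s) = conj (ψ s) := by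
  obtain ⟨φ₁, hφ₁⟩ := hh.isExactOn_ball
  obtain ⟨φ, hφ⟩ := DifferentiableOn.isExactOn_ball (f := φ₁) (c := 0) (r := R) fun s hs =>
    (hφ₁ s hs).differentiableAt.differentiableWithinAt
  have hcj : ∀ s ∈ ball (0 : ℂ) R, conj s ∈ ball (0 : ℂ) R := fun s hs => by
    rw [conj_mem_ball]; simpa using hs
  have hcc : ∀ {f f' : ℂ → ℂ}, (∀ s ∈ ball (0 : ℂ) R, HasDerivAt f (f' s) s) →
      ∀ s ∈ ball (0 : ℂ) R, HasDerivAt (fun s => (f s + conj (f (conj s))) / 2)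
        ((f' s + conj (f' (conj s))) / 2) s := by
    intro f f' hf s hs
    have h1 := (hf _ (hcj s hs)).conj_conj
    rw [Complex.conj_conj] at h1
    exact ((hf s hs).add h1).div_const 2
  -- Averaging with the Schwarz reflection makes the primitives symmetric and leaves `h` unchanged,
  -- because `h` is symmetric already.
  refine ⟨fun s => (φ s + conj (φ (conj s))) / 2, fun s => (φ₁ s + conj (φ₁ (conj s))) / 2,
    hcc hφ, fun s hs => ?_, fun s => ?_⟩
  · refine (hcc hφ₁ s hs).congr_deriv ?_
    rw [hc, Complex.conj_conj]
    ring
  · simp [add_comm, Complex.conj_ofNat]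

/-! ### Projective targets -/

section Proj

variable {H : Type*} [NormedAddCommGroup H] [InnerProductSpace ℂ H] [CompleteSpace H]

/-- All zeros are `-log P + (2n + 1) π i`, and `|2n + 1| ≥ 1` for every integer `n`, so none is
closer to `0` than the one with `n = 0`. -/
theorem one_add_mul_exp_ne_zero {P : ℝ} (hP : 0 < P) {s : ℂ}
    (hs : s ∈ ball (0 : ℂ) ‖(-Real.log P + Real.pi * Complex.I : ℂ)‖) :
    1 + P * Complex.exp s ≠ 0 := by
  intro h
  have hPc : (P : ℂ) ≠ 0 := by exact_mod_cast hP.ne'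
  have e0 : P * Complex.exp (-Real.log P + Real.pi * Complex.I) = -1 := by
    rw [Complex.exp_add, Complex.exp_pi_mul_I, Complex.exp_neg, ← Complex.ofReal_exp,
      Real.exp_log hP]
    field_simp
  have e1 : Complex.exp s = Complex.exp (-Real.log P + Real.pi * Complex.I) := by
    apply mul_left_cancel₀ hPc
    linear_combination h - e0
  obtain ⟨n, hn⟩ := Complex.exp_eq_exp_iff_exists_int.1 e1
  rw [mem_ball_zero_iff, hn] at hs
  have h2 := pow_lt_pow_left₀ hs (norm_nonneg _) two_ne_zero
  rw [← Complex.normSq_eq_norm_sq, ← Complex.normSq_eq_norm_sq, Complex.normSq_apply,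
    Complex.normSq_apply] at h2
  simp only [Complex.add_re, Complex.neg_re, Complex.ofReal_re, Complex.mul_re, Complex.I_re,
    mul_zero, Complex.ofReal_im, Complex.I_im, mul_one, sub_self, add_zero, Complex.intCast_re,
    Complex.re_ofNat, Complex.im_ofNat, Complex.mul_im, Complex.intCast_im, zero_mul,
    Complex.add_im, Complex.neg_im, neg_zero, zero_add, sub_zero] at h2
  have h3 : Real.pi * Real.pi * (1 + 2 * (n : ℝ)) ^ 2 < Real.pi * Real.pi := by nlinarith
  have hpi : 0 < Real.pi * Real.pi := mul_pos Real.pi_pos Real.pi_pos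
  have h4 : (1 + 2 * (n : ℝ)) ^ 2 < 1 := by
    by_contra hcon
    nlinarith [not_lt.1 hcon]
  have h5 : (1 + 2 * n) ^ 2 < 1 := by exact_mod_cast h4
  have h6 : 1 + 2 * n = 0 := by
    have := (sq_lt_one_iff_abs_lt_one _).1 h5
    exact Int.abs_lt_one_iff.1 this
  omega

theorem not_proj_immersion_cigar {b c r : ℝ} {p : ℂ} (hb : 0 < b) (hc : 0 < c) (hr : 0 < r)
    (hp : p ≠ 0) {F : ℂ → H} (hF : DifferentiableOn ℂ F (ball p r))
    (hF0 : ∀ z ∈ ball p r, F z ≠ 0)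
    (hm : ∀ z ∈ ball p r, fubiniStudy b (F z) (deriv F z) = c * cigar z) : False := by
  set P : ℝ := ‖p‖ ^ 2 with hPdef
  have hP : 0 < P := pow_pos (norm_pos_iff.2 hp) 2
  set s₀ : ℂ := -Real.log P + Real.pi * Complex.I with hs₀
  set R : ℝ := ‖s₀‖ with hR
  have hR0 : 0 < R := by
    have h1 : |s₀.im| ≤ R := Complex.abs_im_le_norm s₀
    have h2 : s₀.im = Real.pi := by simp [hs₀]
    rw [h2, abs_of_pos Real.pi_pos] at h1
    exact Real.pi_pos.trans_le h1
  have hX : ∀ s ∈ ball (0 : ℂ) R, 1 + P * Complex.exp s ≠ 0 := fun s hs =>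
    one_add_mul_exp_ne_zero hP hs
  -- The cigar coefficient in the coordinate `q = p eᶻ` is `|q|² / (1 + |q|²)`, and `|q|² = P exp (z
  -- + z̄)`.
  set h : ℂ → ℂ := fun s => P * Complex.exp s / (1 + P * Complex.exp s) with hh
  have hd : DifferentiableOn ℂ h (ball 0 R) :=
    DifferentiableOn.div (by fun_prop) (by fun_prop) hX
  obtain ⟨ψ, ψ₁, hψ, hψ₁, hψc⟩ := exists_second_primitive_conj hd fun s => by
    simp [hh, ← Complex.exp_conj]
  obtain ⟨r₁, hr₁, hmaps⟩ : ∃ r₁ > 0, ∀ z ∈ ball (0 : ℂ) r₁, p * Complex.exp z ∈ ball p r := by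
    have hcont : ContinuousAt (fun z => p * Complex.exp z) 0 := by fun_prop
    have := hcont.preimage_mem_nhds (t := ball p r) (by simpa using ball_mem_nhds p hr)
    obtain ⟨ε, hε, hb⟩ := Metric.mem_nhds_iff.1 this
    exact ⟨ε, hε, hb⟩
  set r₂ := min r₁ (R / 2) with hr₂
  have hr₂0 : 0 < r₂ := lt_min hr₁ (by positivity)
  have hr₂R : 2 * r₂ ≤ R := by have := min_le_right r₁ (R / 2); linarith
  have hmaps₂ : ∀ z ∈ ball (0 : ℂ) r₂, p * Complex.exp z ∈ ball p r := fun z hz =>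
    hmaps z (ball_subset_ball (min_le_left _ _) hz)
  have hsub : ball (0 : ℂ) (2 * r₂) ⊆ ball 0 R := ball_subset_ball hr₂R
  have dF : ∀ z ∈ ball (0 : ℂ) r₂, HasDerivAt (fun z => F (p * Complex.exp z))
      ((p * Complex.exp z) • deriv F (p * Complex.exp z)) z := fun z hz =>
    (hF.hasDerivAt (isOpen_ball.mem_nhds (hmaps₂ z hz))).scomp z
      ((Complex.hasDerivAt_exp z).const_mul p)
  obtain ⟨r', hr'0, hr'r, G, hG, hGγ⟩ := exists_inner_eq_exp (μ := b * c) (h := h) (ψ := ψ)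
    (ψ₁ := ψ₁) hr₂0 (F := fun z => F (p * Complex.exp z))
    (fun z hz => (dF z hz).differentiableAt.differentiableWithinAt)
    (hF0 _ (hmaps₂ 0 (mem_ball_self hr₂0)))
    (fun s hs => hψ s (hsub hs)) (fun s hs => hψ₁ s (hsub hs)) (fun s _ => hψc s)
    (hd.mono hsub) (by
      intro z hz
      rw [(dF z hz).deriv]
      set q := p * Complex.exp z with hq
      have hm' := hm q (hmaps₂ z hz)
      have hq0 : (0 : ℝ) < 1 + ‖q‖ ^ 2 := by positivity
      have hFq : 0 < ‖F q‖ := norm_pos_iff.2 (hF0 q (hmaps₂ z hz))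
      have e1 : (P : ℂ) * Complex.exp (z + conj z) = ((‖q‖ ^ 2 : ℝ) : ℂ) := by
        rw [← Complex.normSq_eq_norm_sq, ← Complex.mul_conj, hPdef, ← Complex.normSq_eq_norm_sq,
          ← Complex.mul_conj, Complex.exp_add, hq, map_mul, ← Complex.exp_conj]
        ring
      simp only [hh]
      rw [e1, norm_smul q, inner_smul_right, norm_mul q]
      have key : ‖F q‖ ^ 2 * (‖q‖ * ‖deriv F q‖) ^ 2 - (‖q‖ * ‖⟪F q, deriv F q⟫_ℂ‖) ^ 2 =
          b * c * (‖q‖ ^ 2 / (1 + ‖q‖ ^ 2)) * ‖F q‖ ^ 4 := by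
        rw [fubiniStudy, cigar] at hm'
        field_simp at hm' ⊢
        linear_combination ‖q‖ ^ 2 * hm'
      exact_mod_cast congrArg (fun x : ℝ => (x : ℂ)) key)
  set μ : ℂ := ((b * c : ℝ) : ℂ) with hμ
  have hμ0 : μ ≠ 0 := Complex.ofReal_ne_zero.2 (mul_pos hb hc).ne'
  set γ : ℂ → ℂ := fun s => Complex.exp (μ * ψ s) with hγ
  have dγ : ∀ s ∈ ball (0 : ℂ) R, HasDerivAt γ (γ s * (μ * ψ₁ s)) s := fun s hs =>
    ((hψ s hs).const_mul μ).cexp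
  have ddγ : ∀ s ∈ ball (0 : ℂ) R, HasDerivAt (deriv γ)
      (γ s * (μ * ψ₁ s) * (μ * ψ₁ s) + γ s * (μ * h s)) s := fun s hs => by
    refine ((dγ s hs).mul ((hψ₁ s hs).const_mul μ)).congr_of_eventuallyEq ?_
    filter_upwards [isOpen_ball.mem_nhds hs] with w hw using (dγ w hw).deriv
  have odeγ : ∀ s ∈ ball (0 : ℂ) R, (1 + P * Complex.exp s) *
      (deriv (deriv γ) s * γ s - deriv γ s ^ 2) = μ * (P * Complex.exp s) * γ s ^ 2 := by
    intro s hs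
    rw [(ddγ s hs).deriv, (dγ s hs).deriv]
    have := hX s hs
    simp only [hh]
    field_simp
    ring
  -- The bound `r' / 2` keeps `i y` where `G` is defined; the bound `1` ensures `0 < y < 2π`, which
  -- is what makes `i y` closer than `0` to `s₀`, whose imaginary part is `π`.
  set y : ℝ := min (r' / 2) 1 with hy
  have hy0 : 0 < y := lt_min (by positivity) one_pos
  have hyr : |y| < r' := by
    rw [abs_of_pos hy0]; have := min_le_left (r' / 2) 1; linarith
  have hy1 : y ≤ 1 := min_le_right _ _
  have hyR : ‖s₀ - y * Complex.I‖ < R := by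
    refine lt_of_pow_lt_pow_left₀ 2 (norm_nonneg _) ?_
    rw [hR, ← Complex.normSq_eq_norm_sq, ← Complex.normSq_eq_norm_sq, Complex.normSq_apply,
      Complex.normSq_apply]
    have := Real.pi_gt_three
    simp [hs₀]
    nlinarith
  obtain ⟨ρ, hρ, hρR⟩ := exists_between hyR
  have hρ0 : 0 < ρ := (norm_nonneg _).trans_lt hρ
  obtain ⟨Γ, hΓ, hΓγ⟩ := exists_continuation_of_inner_eq hr'0 (by linarith) hG
    (fun s hs => (dγ s hs).differentiableAt.differentiableWithinAt) hGγ hyr hρ0 hρR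
  have hyb : (y * Complex.I : ℂ) ∈ ball (0 : ℂ) R := by
    simp only [mem_ball_zero_iff, norm_mul, Complex.norm_real, Complex.norm_I, mul_one,
      Real.norm_eq_abs]
    linarith
  have hs₀b : s₀ ∈ ball (y * Complex.I : ℂ) ρ := by rwa [mem_ball, dist_eq_norm]
  have hΓa : AnalyticOnNhd ℂ Γ (ball (y * Complex.I : ℂ) ρ) := hΓ.analyticOnNhd isOpen_ball
  have hpre := (convex_ball (y * Complex.I : ℂ) ρ).isPreconnected
  have hyc : (y * Complex.I : ℂ) ∈ ball (y * Complex.I : ℂ) ρ := mem_ball_self hρ0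
  have ode : Set.EqOn (fun s => (1 + P * Complex.exp s) *
      (deriv (deriv Γ) s * Γ s - deriv Γ s ^ 2)) (fun s => μ * (P * Complex.exp s) * Γ s ^ 2)
      (ball (y * Complex.I : ℂ) ρ) := by
    refine AnalyticOnNhd.eqOn_of_preconnected_of_eventuallyEq (𝕜 := ℂ) ?_ ?_ hpre hyc ?_
    · have h1 := hΓ.deriv isOpen_ball
      have h2 := h1.deriv isOpen_ball
      have h3 : DifferentiableOn ℂ (fun s => (1 + P * Complex.exp s) *
        (deriv (deriv Γ) s * Γ s - deriv Γ s ^ 2)) (ball (y * Complex.I : ℂ) ρ) := by fun_prop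
      exact h3.analyticOnNhd isOpen_ball
    · have h3 : DifferentiableOn ℂ (fun s => μ * (P * Complex.exp s) * Γ s ^ 2)
        (ball (y * Complex.I : ℂ) ρ) := by fun_prop
      exact h3.analyticOnNhd isOpen_ball
    · filter_upwards [EventuallyEq.eventuallyEq_nhds hΓγ, isOpen_ball.mem_nhds hyb] with s hs hsb
      rw [hs.eq_of_nhds, hs.deriv_eq, hs.deriv.deriv_eq, odeγ s hsb]
  -- By the identity theorem `Γ` would also vanish at `i y`, where it agrees with the exponential
  -- `γ`.
  have hΓne : ¬∀ᶠ z in 𝓝 s₀, Γ z = 0 := by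
    intro hz
    have h1 := hΓa.eqOn_zero_of_preconnected_of_eventuallyEq_zero hpre hs₀b hz hyc
    rw [hΓγ.eq_of_nhds] at h1
    exact Complex.exp_ne_zero _ h1
  refine not_analyticAt_of_log_ode (P := (P : ℂ)) (hΓa s₀ hs₀b) hΓne ?_ hμ0
    (eventually_of_mem (isOpen_ball.mem_nhds hs₀b) ode)
  rw [hs₀, Complex.exp_add, Complex.exp_pi_mul_I, Complex.exp_neg, ← Complex.ofReal_exp,
    Real.exp_log hP]
  have : (P : ℂ) ≠ 0 := by exact_mod_cast hP.ne'
  field_simp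
  ring

end Proj

theorem not_admitsKahlerImmersion_cigar {c : ℝ} (hc : 0 < c) (N : ℕ∞) (b : ℝ) {U : Set ℂ}
    (hU : IsOpen U) (hne : U.Nonempty) :
    ¬ AdmitsKahlerImmersion N b (fun z => c * cigar z) U := by
  rintro (⟨hb, f, hf⟩ | ⟨hb, f, hd, hpos, hm⟩)
  -- The exponential coordinate `p eᶻ` is constant if `p = 0`.
  · obtain ⟨p, hpU, hp0⟩ : ∃ p ∈ U, p ≠ 0 := by
      obtain ⟨q, hq⟩ := hne
      obtain ⟨p, hp, hp0⟩ :=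
        (infinite_of_mem_nhds q (hU.mem_nhds hq)).exists_notMem_finset {0}
      exact ⟨p, hp, by simpa using hp0⟩
    obtain ⟨V, hV, hpV, -, F, hF, hF0, hm⟩ := hf p hpU
    obtain ⟨r, hr, hrV⟩ := Metric.isOpen_iff.1 hV p hpV
    exact not_proj_immersion_cigar hb hc hr hp0 (hF.mono hrV) (fun z hz => (hF0 z (hrV hz)).1)
      fun z hz => hm z (hrV hz)
  · obtain ⟨p, hp⟩ := hne
    obtain ⟨r, hr, hrU⟩ := Metric.isOpen_iff.1 hU p hp
    exact not_ball_immersion_cigar hb hc hr (hd.mono hrU) (fun z hz => hpos z (hrU hz))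
      fun z hz => hm z (hrU hz)

/-! ### The function `L x = ∫₀¹ log (1 + t x) / t dt = -Li₂ (-x)` -/

/-- The plane cut along `(-∞, -1]`. -/
def cutPlane : Set ℂ := {x | 1 + x ∈ Complex.slitPlane}

theorem isOpen_cutPlane : IsOpen cutPlane :=
  Complex.isOpen_slitPlane.preimage (by fun_prop)

theorem mul_mem_cutPlane {x : ℂ} (hx : x ∈ cutPlane) {t : ℝ} (h0 : 0 ≤ t) (h1 : t ≤ 1) :
    (t : ℂ) * x ∈ cutPlane := by
  simp only [cutPlane, Set.mem_ofPred_eq, Complex.mem_slitPlane_iff, Complex.add_re, Complex.one_re,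
    Complex.add_im, Complex.one_im, zero_add, Complex.re_ofReal_mul, Complex.im_ofReal_mul] at hx ⊢
  rcases hx with hx | hx
  · left
    rcases h0.eq_or_lt with rfl | h0
    · simp
    · nlinarith [mul_pos h0 hx]
  · rcases h0.eq_or_lt with rfl | h0
    · left; simp
    · exact Or.inr (mul_ne_zero h0.ne' hx)

theorem zero_mem_cutPlane : (0 : ℂ) ∈ cutPlane := by simp [cutPlane]

theorem conj_mem_cutPlane {x : ℂ} (hx : x ∈ cutPlane) : conj x ∈ cutPlane := by
  simpa [cutPlane, Complex.mem_slitPlane_iff] using hx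

theorem mul_conj_mem_cutPlane (z : ℂ) : z * conj z ∈ cutPlane := by
  rw [Complex.mul_conj, cutPlane, Set.mem_ofPred_eq, Complex.mem_slitPlane_iff]
  left
  have := Complex.normSq_nonneg z
  simp only [Complex.add_re, Complex.one_re, Complex.ofReal_re]
  linarith

/-- `log (1 + x) / x`, continued to `x = 0`. -/
noncomputable def logQuot : ℂ → ℂ := dslope (fun x => Complex.log (1 + x)) 0

theorem hasDerivAt_log_one_add {x : ℂ} (hx : x ∈ cutPlane) :
    HasDerivAt (fun x => Complex.log (1 + x)) (1 + x)⁻¹ x := by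
  simpa using ((hasDerivAt_id x).const_add 1).clog hx

theorem differentiableOn_logQuot : DifferentiableOn ℂ logQuot cutPlane :=
  (Complex.differentiableOn_dslope (isOpen_cutPlane.mem_nhds zero_mem_cutPlane)).2 fun _ hx =>
    (hasDerivAt_log_one_add hx).differentiableAt.differentiableWithinAt

theorem mul_logQuot (x : ℂ) : x * logQuot x = Complex.log (1 + x) := by
  have := sub_smul_dslope (fun x => Complex.log (1 + x)) 0 x
  simpa [logQuot] using this

theorem logQuot_zero : logQuot 0 = 1 := by
  rw [logQuot, dslope_same, (hasDerivAt_log_one_add zero_mem_cutPlane).deriv]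
  simp

/-- For `x = |z|²` and `L' = logQuot`, the left side is `∂∂̄ L (|z|²)`; it is the derivative of `x *
logQuot x = log (1 + x)`. -/
theorem logQuot_add_mul_deriv {x : ℂ} (hx : x ∈ cutPlane) :
    logQuot x + x * deriv logQuot x = (1 + x)⁻¹ := by
  have h1 := (hasDerivAt_id x).mul
    (differentiableOn_logQuot.hasDerivAt (isOpen_cutPlane.mem_nhds hx))
  have h2 := hasDerivAt_value_eq h1 (hasDerivAt_log_one_add hx) univ_mem
    fun w _ => mul_logQuot w
  simpa using h2

/-- The function `-Li₂ (-x)`, as an integral. -/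
noncomputable def dilogNeg (x : ℂ) : ℂ := ∫ t in (0 : ℝ)..1, Complex.log (1 + t * x) / t

theorem intervalIntegrable_dilogNeg {x : ℂ} (hx : x ∈ cutPlane) :
    IntervalIntegrable (fun t : ℝ => Complex.log (1 + t * x) / t) volume 0 1 := by
  have hc : ContinuousOn (fun t : ℝ => x * logQuot (t * x)) (Set.uIcc 0 1) := by
    rw [Set.uIcc_of_le zero_le_one]
    refine continuousOn_const.mul (differentiableOn_logQuot.continuousOn.comp (by fun_prop) ?_)
    exact fun t ht => mul_mem_cutPlane hx ht.1 ht.2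
  refine hc.intervalIntegrable.congr ?_
  rw [Set.uIoc_of_le zero_le_one]
  intro t ht
  have ht0 : (t : ℂ) ≠ 0 := by exact_mod_cast ht.1.ne'
  simp only [← mul_logQuot]
  field_simp

/-- Differentiation under the integral cancels the denominator `t`: the integrand becomes `(1 + t
x)⁻¹`, bounded on compact sets because the cut plane is star-shaped about `0`. Its integral over
`[0, 1]` is `log (1 + x) / x`. -/
theorem hasDerivAt_dilogNeg {x : ℂ} (hx : x ∈ cutPlane) :
    HasDerivAt dilogNeg (logQuot x) x := by
  obtain ⟨ε, hε, hb⟩ := Metric.nhds_basis_closedBall.mem_iff.1 (isOpen_cutPlane.mem_nhds hx)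
  have hne : ∀ y ∈ cutPlane, ∀ t ∈ Set.Icc (0 : ℝ) 1, 1 + (t : ℂ) * y ≠ 0 := fun y hy t ht =>
    Complex.slitPlane_ne_zero (mul_mem_cutPlane hy ht.1 ht.2)
  obtain ⟨C, hC⟩ := ((isCompact_closedBall x ε).prod (isCompact_Icc (a := (0 : ℝ))
    (b := 1))).exists_bound_of_continuousOn (f := fun q : ℂ × ℝ => (1 + (q.2 : ℂ) * q.1)⁻¹)
    (ContinuousOn.inv₀ (by fun_prop) fun q hq => hne q.1 (hb hq.1) q.2 hq.2)
  have hIoc : Set.uIoc (0 : ℝ) 1 = Set.Ioc 0 1 := Set.uIoc_of_le zero_le_one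
  have hcd : ContinuousOn (fun t : ℝ => (1 + (t : ℂ) * x)⁻¹) (Set.uIcc 0 1) := by
    rw [Set.uIcc_of_le zero_le_one]
    exact ContinuousOn.inv₀ (by fun_prop) fun t ht => hne x hx t ht
  have key := (intervalIntegral.hasDerivAt_integral_of_dominated_loc_of_deriv_le
    (F := fun x (t : ℝ) => Complex.log (1 + t * x) / t)
    (F' := fun x (t : ℝ) => (1 + (t : ℂ) * x)⁻¹) (x₀ := x) (bound := fun _ => C) (a := 0) (b := 1)
    (μ := volume) (closedBall_mem_nhds x hε)
    (by
      filter_upwards [closedBall_mem_nhds x hε] with y hy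
      exact (intervalIntegrable_iff.1 (intervalIntegrable_dilogNeg (hb hy))).aestronglyMeasurable)
    (intervalIntegrable_dilogNeg hx)
    (intervalIntegrable_iff.1 hcd.intervalIntegrable).aestronglyMeasurable
    (by
      refine ae_of_all _ fun t ht y hy => ?_
      rw [hIoc] at ht
      exact hC (y, t) ⟨hy, ht.1.le, ht.2⟩)
    intervalIntegrable_const
    (by
      refine ae_of_all _ fun t ht y hy => ?_
      rw [hIoc] at ht
      have ht0 : (t : ℂ) ≠ 0 := by exact_mod_cast ht.1.ne'
      have h1 := (hasDerivAt_log_one_add (mul_mem_cutPlane (hb hy) ht.1.le ht.2)).comp y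
        ((hasDerivAt_id y).const_mul (t : ℂ))
      refine (h1.div_const (t : ℂ)).congr_deriv ?_
      field_simp)).2
  refine key.congr_deriv ?_
  rcases eq_or_ne x 0 with rfl | hx0
  · simp [logQuot_zero]
  have hF : ∀ t ∈ Set.uIcc (0 : ℝ) 1, HasDerivAt (fun t : ℝ => Complex.log (1 + t * x) / x)
      (1 + (t : ℂ) * x)⁻¹ t := by
    intro t ht
    rw [Set.uIcc_of_le zero_le_one] at ht
    have h1 := (hasDerivAt_log_one_add (mul_mem_cutPlane hx ht.1 ht.2)).comp (t : ℂ)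
      ((hasDerivAt_id (t : ℂ)).mul_const x)
    refine ((h1.div_const x).comp_ofReal).congr_deriv ?_
    field_simp
  rw [intervalIntegral.integral_eq_sub_of_hasDerivAt hF hcd.intervalIntegrable, ← mul_logQuot,
    ← mul_logQuot]
  simp [hx0]

theorem dilogNeg_conj {x : ℂ} (hx : x ∈ cutPlane) : dilogNeg (conj x) = conj (dilogNeg x) := by
  rw [dilogNeg, dilogNeg, intervalIntegral.integral_of_le zero_le_one,
    intervalIntegral.integral_of_le zero_le_one, ← integral_conj]
  refine setIntegral_congr_fun measurableSet_Ioc fun t ht => ?_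
  have h := Complex.slitPlane_arg_ne_pi (mul_mem_cutPlane hx ht.1.le ht.2)
  simp only [map_div₀, Complex.conj_ofReal]
  rw [← Complex.log_conj _ h]
  simp

/-- The real part of `dilogNeg`, continued to the cut. -/
noncomputable def dilogNegRe (x : ℂ) : ℝ := ∫ t in (0 : ℝ)..1, Real.log ‖1 + t * x‖ / t

theorem re_dilogNeg {x : ℂ} (hx : x ∈ cutPlane) : (dilogNeg x).re = dilogNegRe x := by
  have h := Complex.reCLM.intervalIntegral_comp_comm (intervalIntegrable_dilogNeg hx)
  simp only [Complex.reCLM_apply, Complex.div_ofReal_re, Complex.log_re] at h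
  exact h.symm

theorem dilogNeg_mul_conj (z : ℂ) : dilogNeg (z * conj z) = dilogNegRe (z * conj z) := by
  have h := dilogNeg_conj (mul_conj_mem_cutPlane z)
  rw [map_mul, Complex.conj_conj, mul_comm] at h
  rw [← re_dilogNeg (mul_conj_mem_cutPlane z)]
  exact (Complex.conj_eq_iff_re.1 h.symm).symm

/-! ### Continuity across the cut -/

/-- An integrable bound for `log |1 + s u| / s`, `|u| = 1`. -/
noncomputable def dilogBound (s : ℝ) : ℝ := 3 + 2 * (|s| + |Real.log (1 - s)| + |Real.log (1 + s)|)

theorem intervalIntegrable_dilogBound (a b : ℝ) : IntervalIntegrable dilogBound volume a b := by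
  have h1 : IntervalIntegrable (fun s => Real.log (1 - s)) volume a b := by
    have := (intervalIntegral.intervalIntegrable_log' (a := 1 - a) (b := 1 - b)).comp_sub_left 1
    simpa using this
  have h2 : IntervalIntegrable (fun s => Real.log (1 + s)) volume a b := by
    have := (intervalIntegral.intervalIntegrable_log' (a := 1 + a) (b := 1 + b)).comp_add_left 1
    simpa using this
  have h3 : IntervalIntegrable (fun s : ℝ => |s|) volume a b :=
    (continuous_abs).intervalIntegrable _ _
  exact intervalIntegrable_const.add (((h3.add h1.abs).add h2.abs).const_mul 2)

/-- From `|1 - |s|| ≤ ‖1 + s u‖ ≤ 1 + |s|` the logarithm is at most `|s| + |log (1 - |s|)|` in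
absolute value. For `|s| ≤ 1/2` this is at most `3 |s|`, whence the constant 3; for `|s| ≥ 1/2`
division by `s` costs at most the factor 2. -/
theorem abs_log_norm_one_add_div_le {u : ℂ} (hu : ‖u‖ = 1) {s : ℝ} (h1 : s ≠ 1) (h2 : s ≠ -1) :
    ‖Real.log ‖1 + s * u‖ / s‖ ≤ dilogBound s := by
  have hsu : ‖(s : ℂ) * u‖ = |s| := by rw [norm_mul, hu, mul_one, Complex.norm_real]; rfl
  have hup : ‖1 + s * u‖ ≤ 1 + |s| := by
    have := norm_add_le (1 : ℂ) (s * u)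
    rwa [hsu, norm_one] at this
  have hlo : |(1 - |s|)| ≤ ‖1 + s * u‖ := by
    have := abs_norm_sub_norm_le (1 : ℂ) (-(s * u))
    rwa [norm_neg, hsu, norm_one, sub_neg_eq_add] at this
  have hs1 : |s| ≠ 1 := fun h => by
    rcases (abs_eq zero_le_one).1 h with h | h
    · exact h1 h
    · exact h2 h
  have hpos : 0 < |(1 - |s|)| := abs_pos.2 (sub_ne_zero.2 hs1.symm)
  have e1 : Real.log ‖1 + s * u‖ ≤ |s| := by
    have := Real.log_le_sub_one_of_pos (hpos.trans_le hlo)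
    linarith
  have e2 : -|Real.log (1 - |s|)| ≤ Real.log ‖1 + s * u‖ := by
    have h3 := Real.log_le_log hpos hlo
    rw [Real.log_abs] at h3
    exact (neg_abs_le _).trans h3
  have hl : |Real.log ‖1 + s * u‖| ≤ |s| + |Real.log (1 - |s|)| := by
    rw [abs_le]
    constructor
    · have := abs_nonneg s; linarith
    · have := abs_nonneg (Real.log (1 - |s|)); linarith
  have hsplit : |Real.log (1 - |s|)| ≤ |Real.log (1 - s)| + |Real.log (1 + s)| := by
    rcases abs_choice s with h | h <;> rw [h]
    · have := abs_nonneg (Real.log (1 + s)); linarith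
    · have := abs_nonneg (Real.log (1 - s)); rw [sub_neg_eq_add]; linarith
  rw [norm_div, Real.norm_eq_abs, Real.norm_eq_abs, dilogBound]
  have n1 := abs_nonneg (Real.log (1 - s))
  have n2 := abs_nonneg (Real.log (1 + s))
  have n3 := abs_nonneg s
  refine div_le_of_le_mul₀ n3 (by positivity) (hl.trans ?_)
  rcases le_total |s| (1 / 2) with hs | hs
  · have hp : 0 < 1 - |s| := by linarith
    have h3 : |Real.log (1 - |s|)| ≤ 2 * |s| := by
      rw [abs_of_nonpos (Real.log_nonpos hp.le (by linarith))]
      have h4 := Real.one_sub_inv_le_log_of_pos hp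
      have h5 : (1 - |s|)⁻¹ ≤ 1 + 2 * |s| := by
        rw [inv_le_iff_one_le_mul₀ hp]
        nlinarith
      linarith
    nlinarith
  · nlinarith

/-- The substitution `s = t ‖x‖` moves the possible singularities to `s = ±1`, independently of `x`,
so that `dilogBound` dominates all these integrands at once; the dependence on `‖x‖` passes to the
endpoint. -/
theorem dilogNegRe_eq_integral {x : ℂ} (hx : x ≠ 0) :
    dilogNegRe x = ∫ s in (0 : ℝ)..‖x‖, Real.log ‖1 + s * (x / ‖x‖)‖ / s := by
  have hn : ‖x‖ ≠ 0 := norm_ne_zero_iff.2 hx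
  have hnc : (‖x‖ : ℂ) ≠ 0 := by exact_mod_cast hn
  have h := intervalIntegral.smul_integral_comp_mul_right (a := 0) (b := 1)
    (fun s : ℝ => Real.log ‖1 + s * (x / ‖x‖)‖ / s) ‖x‖
  rw [zero_mul, one_mul] at h
  rw [← h, smul_eq_mul, ← intervalIntegral.integral_const_mul, dilogNegRe]
  congr 1
  ext t
  have e : ((t * ‖x‖ : ℝ) : ℂ) * (x / ‖x‖) = t * x := by
    push_cast
    field_simp
  rw [e]
  rcases eq_or_ne t 0 with rfl | ht
  · simp
  · field_simp

theorem norm_div_norm_self {x : ℂ} (hx : x ≠ 0) : ‖x / (‖x‖ : ℂ)‖ = 1 := by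
  rw [norm_div, Complex.norm_real, norm_norm, div_self (norm_ne_zero_iff.2 hx)]

theorem intervalIntegrable_dilogNegRe (x : ℂ) :
    IntervalIntegrable (fun t : ℝ => Real.log ‖1 + t * x‖ / t) volume 0 1 := by
  rcases eq_or_ne x 0 with rfl | hx
  · simp
  have hn : ‖x‖ ≠ 0 := norm_ne_zero_iff.2 hx
  have hnc : (‖x‖ : ℂ) ≠ 0 := by exact_mod_cast hn
  have hb : IntervalIntegrable (fun t => ‖x‖ * dilogBound (t * ‖x‖)) volume 0 1 := by
    have := (intervalIntegrable_dilogBound 0 ‖x‖).comp_mul_right (c := ‖x‖)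
    rw [zero_div, div_self hn] at this
    exact this.const_mul _
  refine hb.mono_fun' (Measurable.aestronglyMeasurable (by fun_prop)) ?_
  have hae : ∀ c : ℝ, ∀ᵐ t : ℝ ∂volume.restrict (Set.uIoc 0 1), t ≠ c := fun c =>
    ae_restrict_of_ae (by simp [ae_iff])
  filter_upwards [hae ‖x‖⁻¹, hae (-‖x‖⁻¹)] with t h1 h2
  have key := abs_log_norm_one_add_div_le (norm_div_norm_self hx) (s := t * ‖x‖)
    (fun h => h1 (by field_simp; exact h)) (fun h => h2 (by field_simp; linarith))
  have e : ((t * ‖x‖ : ℝ) : ℂ) * (x / ‖x‖) = t * x := by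
    push_cast
    field_simp
  rw [e, ← div_div, norm_div, norm_norm, div_le_iff₀ (norm_pos_iff.2 hx)] at key
  rwa [mul_comm ‖x‖]

theorem continuous_dilogNegRe : Continuous dilogNegRe := by
  rw [continuous_iff_continuousAt]
  intro x
  -- The direction `x / ‖x‖` is discontinuous at `0`, but there the holomorphic `dilogNeg` gives
  -- continuity.
  rcases eq_or_ne x 0 with rfl | hx
  · have h1 : ContinuousAt (fun x => (dilogNeg x).re) 0 :=
      Complex.continuous_re.continuousAt.comp (hasDerivAt_dilogNeg zero_mem_cutPlane).continuousAt
    refine h1.congr ?_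
    filter_upwards [isOpen_cutPlane.mem_nhds zero_mem_cutPlane] with x hx using re_dilogNeg hx
  have hn : 0 < ‖x‖ := norm_pos_iff.2 hx
  have hae : ∀ c : ℝ, ∀ᵐ t : ℝ ∂volume.restrict (Set.uIoc (-1) (‖x‖ + 1)), t ≠ c := fun c =>
    ae_restrict_of_ae (by simp [ae_iff])
  have hne : ∀ᶠ y : ℂ in 𝓝 x, y ≠ 0 := isOpen_ne.mem_nhds hx
  -- Joint continuity in direction and endpoint. The interval from `-1` to `‖x‖ + 1` is chosen so
  -- that `0` and `‖x‖` are interior.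
  have key := intervalIntegral.continuousAt_parametric_primitive_of_dominated
    (F := fun (y : ℂ) (s : ℝ) => Real.log ‖1 + s * (y / ‖y‖)‖ / s) (μ := volume) (x₀ := x)
    dilogBound (-1) (‖x‖ + 1) (a₀ := 0) (b₀ := ‖x‖)
    (fun y => Measurable.aestronglyMeasurable (by fun_prop))
    (by
      filter_upwards [hne] with y hy
      filter_upwards [hae 1, hae (-1)] with s h1 h2
      exact abs_log_norm_one_add_div_le (norm_div_norm_self hy) h1 h2)
    (intervalIntegrable_dilogBound _ _)
    (by
      filter_upwards [hae 1, hae (-1)] with s h1 h2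
      have hxn : (‖x‖ : ℂ) ≠ 0 := by exact_mod_cast hn.ne'
      refine ContinuousAt.div_const (ContinuousAt.log ?_ ?_) s
      · exact (continuousAt_const.add (continuousAt_const.mul (continuousAt_id.div
          (Complex.continuous_ofReal.continuousAt.comp continuous_norm.continuousAt) hxn))).norm
      · intro h0
        have h3 : (s : ℂ) * (x / ‖x‖) = -1 := by
          have := norm_eq_zero.1 h0
          linear_combination this
        have h4 := congrArg norm h3
        rw [norm_mul, norm_div_norm_self hx, mul_one, norm_neg, norm_one, Complex.norm_real,
          Real.norm_eq_abs] at h4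
        rcases (abs_eq zero_le_one).1 h4 with h | h
        · exact h1 h
        · exact h2 h)
    ⟨by norm_num, by linarith⟩ ⟨by linarith, by linarith⟩ (by simp)
  have h2 : ContinuousAt (fun y : ℂ => ∫ s in (0 : ℝ)..‖y‖, Real.log ‖1 + s * (y / ‖y‖)‖ / s) x :=
    ContinuousAt.comp (f := fun y : ℂ => (y, ‖y‖)) (g := fun p : ℂ × ℝ =>
      ∫ s in (0 : ℝ)..p.2, Real.log ‖1 + s * (p.1 / ‖p.1‖)‖ / s) key (by fun_prop)
  refine h2.congr ?_
  filter_upwards [hne] with y hy using (dilogNegRe_eq_integral hy).symm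

/-! ### The Kähler potential -/

theorem hasFDerivAt_comp_mul_conj {f : ℂ → ℂ} {f' z : ℂ} (hf : HasDerivAt f f' (z * conj z)) :
    ∃ A : ℂ →L[ℝ] ℂ, HasFDerivAt (fun w => f (w * conj w)) A z ∧
      ∀ v, A v = f' * (z * conj v + conj z * v) := by
  have h1 : HasFDerivAt (fun w : ℂ => w * conj w)
      (z • (Complex.conjCLE : ℂ →L[ℝ] ℂ) + conj z • ContinuousLinearMap.id ℝ ℂ) z :=
    (hasFDerivAt_id (𝕜 := ℝ) z).mul (Complex.conjCLE : ℂ →L[ℝ] ℂ).hasFDerivAt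
  have h2 := (hf.hasFDerivAt.restrictScalars ℝ).comp z h1
  refine ⟨_, h2, fun v => ?_⟩
  simp
  ring

theorem dzbar_dilogNeg_mul_conj (z : ℂ) :
    dzbar (fun w => dilogNeg (w * conj w)) z = logQuot (z * conj z) * z := by
  obtain ⟨A, hA, hAv⟩ := hasFDerivAt_comp_mul_conj (hasDerivAt_dilogNeg (mul_conj_mem_cutPlane z))
  rw [dzbar, hA.fderiv, hAv, hAv, map_one, Complex.conj_I]
  linear_combination (logQuot (z * conj z) * (conj z - z) / 2) * Complex.I_sq

theorem dz_logQuot_mul_conj_mul (z : ℂ) :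
    dz (fun w => logQuot (w * conj w) * w) z = (1 + z * conj z)⁻¹ := by
  have hz := mul_conj_mem_cutPlane z
  obtain ⟨A, hA, hAv⟩ := hasFDerivAt_comp_mul_conj
    (differentiableOn_logQuot.hasDerivAt (isOpen_cutPlane.mem_nhds hz))
  have h := hA.mul (hasFDerivAt_id (𝕜 := ℝ) z)
  have e : fderiv ℝ (fun w => logQuot (w * conj w) * w) z = _ := h.fderiv
  rw [dz, e, ← logQuot_add_mul_deriv hz]
  simp [hAv]
  linear_combination (-logQuot (z * conj z) / 2 -
    z * deriv logQuot (z * conj z) * (conj z - z) / 2) * Complex.I_sq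

theorem analyticOnNhd_dilogNegRe_mul_conj :
    AnalyticOnNhd ℝ (fun z : ℂ => dilogNegRe (z * conj z)) Set.univ := by
  have h1 : AnalyticOnNhd ℝ (fun z : ℂ => z * conj z) Set.univ := fun z _ =>
    analyticAt_id.mul ((Complex.conjCLE : ℂ →L[ℝ] ℂ).analyticAt z)
  have h2 : AnalyticOnNhd ℂ dilogNeg cutPlane :=
    DifferentiableOn.analyticOnNhd (fun x hx =>
      (hasDerivAt_dilogNeg hx).differentiableAt.differentiableWithinAt) isOpen_cutPlane
  intro z _
  have h3 := AnalyticAt.comp (f := fun z : ℂ => z * conj z)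
    ((h2 _ (mul_conj_mem_cutPlane z)).restrictScalars (𝕜 := ℝ)) (h1 z trivial)
  have h4 : AnalyticAt ℝ (fun z : ℂ => (dilogNeg (z * conj z)).re) z :=
    (Complex.reCLM.analyticAt _).comp h3
  refine h4.congr (Eventually.of_forall fun w => ?_)
  exact re_dilogNeg (mul_conj_mem_cutPlane w)

theorem isKahlerPotential_cigar :
    IsKahlerPotential cigar fun z => dilogNegRe (z * conj z) := by
  refine ⟨analyticOnNhd_dilogNegRe_mul_conj, fun z => ?_⟩
  have e : dzbar (fun w => (dilogNegRe (w * conj w) : ℂ)) =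
      fun w => logQuot (w * conj w) * w := by
    ext w
    simp only [← dilogNeg_mul_conj]
    exact dzbar_dilogNeg_mul_conj w
  rw [e, dz_logQuot_mul_conj_mul, cigar, Complex.mul_conj, Complex.normSq_eq_norm_sq]
  push_cast
  rw [one_div]

/-! ### The diastasis -/

/-- The diastasis of the cigar metric. -/
noncomputable def cigarDiastasis (z w : ℂ) : ℝ :=
  dilogNegRe (z * conj z) + dilogNegRe (w * conj w) - 2 * dilogNegRe (z * conj w)

theorem continuous_cigarDiastasis :
    Continuous fun p : ℂ × ℂ => cigarDiastasis p.1 p.2 := by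
  have h := continuous_dilogNegRe
  have h1 : Continuous fun p : ℂ × ℂ => p.1 * conj p.1 := by fun_prop
  have h2 : Continuous fun p : ℂ × ℂ => p.2 * conj p.2 := by fun_prop
  have h3 : Continuous fun p : ℂ × ℂ => p.1 * conj p.2 := by fun_prop
  exact ((h.comp h1).add (h.comp h2)).sub (continuous_const.mul (h.comp h3))

theorem norm_one_add_mul_conj_self {t : ℝ} (ht : 0 ≤ t) (z : ℂ) :
    ‖1 + t * (z * conj z)‖ = 1 + t * Complex.normSq z := by
  have h : 0 ≤ 1 + t * Complex.normSq z := by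
    have := Complex.normSq_nonneg z
    positivity
  rw [Complex.mul_conj, ← Complex.ofReal_one, ← Complex.ofReal_mul, ← Complex.ofReal_add,
    Complex.norm_of_nonneg h]

/-- It rests on `(1 + t|z|²) (1 + t|w|²) - |1 + t z w̄|² = t |z - w|²`. -/
theorem two_mul_log_norm_lt {t : ℝ} (ht : 0 < t) {z w : ℂ} (hzw : z ≠ w) :
    2 * Real.log ‖1 + t * (z * conj w)‖ <
      Real.log ‖1 + t * (z * conj z)‖ + Real.log ‖1 + t * (w * conj w)‖ := by
  rw [norm_one_add_mul_conj_self ht.le, norm_one_add_mul_conj_self ht.le]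
  have hz := Complex.normSq_nonneg z
  have hw := Complex.normSq_nonneg w
  have hz1 : 0 < 1 + t * Complex.normSq z := by positivity
  have hw1 : 0 < 1 + t * Complex.normSq w := by positivity
  rcases eq_or_ne (1 + t * (z * conj w)) 0 with h0 | h0
  -- Here `Real.log 0 = 0` makes the left side `0` instead of `-∞`, so strictness has to come from
  -- `1 + t|z|² > 1`.
  · have hz0 : z ≠ 0 := by
      rintro rfl
      simp at h0
    have hz2 : 0 < t * Complex.normSq z := mul_pos ht (Complex.normSq_pos.2 hz0)
    rw [h0, norm_zero, Real.log_zero, mul_zero]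
    have h1 := Real.log_pos (x := 1 + t * Complex.normSq z) (by linarith)
    have h2 := Real.log_nonneg (x := 1 + t * Complex.normSq w) (by
      have := mul_nonneg ht.le hw
      linarith)
    linarith
  · rw [← Real.log_mul hz1.ne' hw1.ne', ← Nat.cast_ofNat, ← Real.log_pow]
    refine Real.log_lt_log (pow_pos (norm_pos_iff.2 h0) 2) ?_
    have hd : 0 < t * Complex.normSq (z - w) := mul_pos ht (Complex.normSq_pos.2 (sub_ne_zero.2 hzw))
    rw [← Complex.normSq_eq_norm_sq]
    simp only [Complex.normSq_apply, Complex.add_re, Complex.add_im, Complex.one_re,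
      Complex.one_im, Complex.ofReal_re, Complex.ofReal_im, Complex.mul_re, Complex.mul_im,
      Complex.conj_re, Complex.conj_im, Complex.sub_re, Complex.sub_im] at hd ⊢
    linarith

theorem cigarDiastasis_pos {z w : ℂ} (hzw : z ≠ w) : 0 < cigarDiastasis z w := by
  have h1 := intervalIntegrable_dilogNegRe (z * conj z)
  have h2 := intervalIntegrable_dilogNegRe (w * conj w)
  have h3 := (intervalIntegrable_dilogNegRe (z * conj w)).const_mul 2
  have e : cigarDiastasis z w = ∫ t in (0 : ℝ)..1, (Real.log ‖1 + t * (z * conj z)‖ / t +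
      Real.log ‖1 + t * (w * conj w)‖ / t - 2 * (Real.log ‖1 + t * (z * conj w)‖ / t)) := by
    rw [intervalIntegral.integral_sub (h1.add h2) h3, intervalIntegral.integral_add h1 h2,
      intervalIntegral.integral_const_mul]
    rfl
  rw [e]
  refine intervalIntegral.intervalIntegral_pos_of_pos_on ((h1.add h2).sub h3) (fun t ht => ?_)
    one_pos
  have h := two_mul_log_norm_lt ht.1 hzw
  have : 0 < (Real.log ‖1 + t * (z * conj z)‖ + Real.log ‖1 + t * (w * conj w)‖ -
      2 * Real.log ‖1 + t * (z * conj w)‖) / t := div_pos (by linarith) ht.1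
  convert this using 1
  ring

theorem cigarDiastasis_nonneg (z w : ℂ) : 0 ≤ cigarDiastasis z w := by
  rcases eq_or_ne z w with rfl | h
  · rw [cigarDiastasis]
    linarith
  · exact (cigarDiastasis_pos h).le

theorem isDiastasisOn_cigar :
    IsDiastasisOn cigar cigarDiastasis {p | 1 + p.1 * conj p.2 ∈ Complex.slitPlane} := by
  have hsymm : ∀ z w : ℂ, z * conj w ∈ cutPlane → w * conj z ∈ cutPlane := fun z w h => by
    have := conj_mem_cutPlane h
    rwa [map_mul, Complex.conj_conj, mul_comm] at this
  refine ⟨Complex.isOpen_slitPlane.preimage (by fun_prop), ?_, mul_conj_mem_cutPlane, hsymm,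
    fun z => dilogNegRe (z * conj z), fun q => dilogNeg (q.1 * q.2), isKahlerPotential_cigar,
    ?_, dilogNeg_mul_conj, ?_⟩
  -- Scaling `(z, w)` by `t` scales `z w̄` by `t²`, and the cut plane is star-shaped about `0`.
  · have hstar : StarConvex ℝ (0 : ℂ × ℂ) {p | 1 + p.1 * conj p.2 ∈ Complex.slitPlane} := by
      rw [starConvex_zero_iff]
      intro p hp t h0 h1
      have := mul_mem_cutPlane (x := p.1 * conj p.2) hp (mul_nonneg h0 h0)
        (mul_le_one₀ h1 h0 h1)
      have e : (t • p).1 * conj (t • p).2 = ((t * t : ℝ) : ℂ) * (p.1 * conj p.2) := by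
        simp
        ring
      change (t • p).1 * conj (t • p).2 ∈ cutPlane
      rwa [e]
    exact (hstar.isPathConnected (mul_conj_mem_cutPlane 0)).isConnected
  · intro q hq
    have hq' : q.1 * q.2 ∈ cutPlane := by
      have : q.1 * conj (conj q.2) ∈ cutPlane := hq
      rwa [Complex.conj_conj] at this
    have h1 : DifferentiableAt ℂ (fun q : ℂ × ℂ => q.1 * q.2) q := by fun_prop
    exact ((hasDerivAt_dilogNeg hq').differentiableAt.comp q h1).differentiableWithinAt
  · intro z w h
    have hc : z * conj w ∈ cutPlane := h
    have e : dilogNeg (w * conj z) = conj (dilogNeg (z * conj w)) := by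
      rw [← dilogNeg_conj hc, map_mul, Complex.conj_conj, mul_comm]
    have e2 := Complex.add_conj (dilogNeg (z * conj w))
    rw [re_dilogNeg hc] at e2
    simp only [e, cigarDiastasis]
    push_cast at e2 ⊢
    linear_combination e2

end Kahler

theorem mainTheorem11 :
    (∃ D : ℂ → ℂ → ℝ,
      Continuous (fun p : ℂ × ℂ => D p.1 p.2) ∧
      Kahler.IsDiastasisOn Kahler.cigar D {p | 1 + p.1 * conj p.2 ∈ Complex.slitPlane} ∧
      (∀ z w : ℂ, 0 ≤ D z w) ∧
      ∀ z w : ℂ, z ≠ w → 0 < D z w) ∧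
    ∀ c : ℝ, 0 < c → ∀ (N : ℕ∞) (b : ℝ) (U : Set ℂ), IsOpen U → U.Nonempty →
      ¬ Kahler.AdmitsKahlerImmersion N b (fun z => c * Kahler.cigar z) U :=
  ⟨⟨Kahler.cigarDiastasis, Kahler.continuous_cigarDiastasis, Kahler.isDiastasisOn_cigar,
    Kahler.cigarDiastasis_nonneg, fun _ _ => Kahler.cigarDiastasis_pos⟩,
    fun _ hc N b _ hU hne => Kahler.not_admitsKahlerImmersion_cigar hc N b hU hne⟩
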